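/- For $r\ge 1$, let the $r$-Kostka cone be the convex hull in $\mathbb R^{2r}$ of all points $(\lambda,\mu)=(\lambda_1,\dots,\lambda_r,\mu_1,\dots,\mu_r)$ such that $\lambda$ and $\mu$ are non-increasing $r$-tuples of nonnegative integers with the same sum and $\lambda$ dominates $\mu$, i.e. $\lambda_1+\dots+\lambda_k\ge\mu_1+\dots+\mu_k$ for all $k\le r$. Let $P_r$ be the polytope obtained by intersecting this cone with the hyperplane $\sum_{i=1}^r(\lambda_i+\mu_i)=1$, and let $f_d(r)$ be the (finite) number of $d$-dimensional faces of $P_r$. The vertices of $P_r$ are labeled by integer triples: for $0\le \ell<b<a\le r$, a vertex on the ray generated by $((a-\ell)^b,0^{r-b};(a-\ell)^\ell,(b-\ell)^{a-\ell},0^{r-a})$ has label $(a,b,\ell)$, and for $1\le a\le r$, a vertex on the ray generated by $(1^a,0^{r-a};1^a,0^{r-a})$ has label $(a,a,a)$. Theorem. Let $d\ge 0$. There is a polynomial of degree exactly $3d+3$ with leading coefficient $\frac1{(3d+3)!}$ whose value at every integer $r\ge1$ is $f_d(r)$. Equivalently, there are nonnegative integers $\alpha_0,\dots,\alpha_{3d+3}$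 with $f_d(r)=\sum_{k=0}^{3d+3}\alpha_k\binom rk$ for all $r\ge1$, where $\alpha_{3d+3}=1$. Moreover, for every $r\ge1$, at most $3d+3$ distinct integers occur as entries of the labels of the vertices of a $d$-face of $P_r$, and the $d$-faces for which exactly $3d+3$ distinct integers occur (the top-degree faces) are exactly the convex hulls of $d+1$ vertices of $P_r$ with labels $(a_i,b_i,\ell_i)$, $\ell_i<b_i<a_i$, whose intervals $[\ell_i,a_i]$ are pairwise disjoint; any such $d+1$ vertices are affinely independent, so these faces are simplices. -/

import Mathlib

noncomputable section

/-- The ambient space `ℝ^{2r}`, a point of which is written as a pair `(lam, mu)` of `r`-tuples. -/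
abbrev KostkaSpace (r : ℕ) : Type := (Fin r → ℝ) × (Fin r → ℝ)

/-- `Dominates lam mu`: for all `k ≤ r`, the first `k` parts of `lam` sum to at least the sum of
the first `k` parts of `mu`. -/
def Dominates {r : ℕ} (lam mu : Fin r → ℕ) : Prop :=
  ∀ k : ℕ, k ≤ r →
    ∑ i ∈ Finset.univ.filter (fun i : Fin r => (i : ℕ) < k), mu i ≤
      ∑ i ∈ Finset.univ.filter (fun i : Fin r => (i : ℕ) < k), lam i

/-- The integer points `(lam, mu)` where `lam` and `mu` are partitions of the same integer into at
most `r` parts (non-increasing `r`-tuples of nonnegative integers) and `lam` dominates `mu`. -/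
def kostkaPoints (r : ℕ) : Set (KostkaSpace r) :=
  {x | ∃ lam mu : Fin r → ℕ, Antitone lam ∧ Antitone mu ∧ ∑ i, lam i = ∑ i, mu i ∧
    Dominates lam mu ∧ x = (fun i => (lam i : ℝ), fun i => (mu i : ℝ))}

/-- The `r`-Kostka cone. -/
def kostkaCone (r : ℕ) : Set (KostkaSpace r) := convexHull ℝ (kostkaPoints r)

/-- The Kostka polytope: the slice of the cone by the hyperplane `∑ (lam i + mu i) = 1`. -/
def kostkaPolytope (r : ℕ) : Set (KostkaSpace r) :=
  {x | x ∈ kostkaCone r ∧ ∑ i, (x.1 i + x.2 i) = 1}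

/-- The `d`-dimensional (nonempty) faces of the Kostka polytope. A face is the set of maximizers
over the polytope of a linear functional; the polytope itself is the face of the functional `0`. -/
def kostkaFaces (r d : ℕ) : Set (Set (KostkaSpace r)) :=
  {F | IsExposed ℝ (kostkaPolytope r) F ∧ F.Nonempty ∧ Module.finrank ℝ (vectorSpan ℝ F) = d}

/-- `f_d(r)`, the number of `d`-dimensional faces of the Kostka polytope. -/
def kostkaFaceNumber (d r : ℕ) : ℕ := (kostkaFaces r d).ncard

/-- A triple `(a, b, ℓ)` of nonnegative integers. -/
@[ext] structure KostkaLabel where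
  a : ℕ
  b : ℕ
  ℓ : ℕ

/-- The vector `((a-ℓ)^b, 0^{r-b} ; (a-ℓ)^ℓ, (b-ℓ)^{a-ℓ}, 0^{r-a})`, used for
`0 ≤ ℓ < b ≤ a ≤ r`. -/
def rayGenerator (r a b ℓ : ℕ) : KostkaSpace r :=
  (fun i => if (i : ℕ) < b then (a : ℝ) - ℓ else 0,
   fun i => if (i : ℕ) < ℓ then (a : ℝ) - ℓ else if (i : ℕ) < a then (b : ℝ) - ℓ else 0)

/-- `HasLabel r v t`: `v` is a vertex of the Kostka polytope that is labeled by the triple `t`.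
If `a ≠ b`, the vertex on the ray of `(a, b, ℓ)` is labeled `(a, b, ℓ)`; if `a = b`, the ray does
not depend on `ℓ` and its vertex is labeled `(a, a, a)`. -/
def HasLabel (r : ℕ) (v : KostkaSpace r) (t : KostkaLabel) : Prop :=
  v ∈ (kostkaPolytope r).extremePoints ℝ ∧ t.a ≤ r ∧
    ((t.ℓ < t.b ∧ t.b < t.a ∧ ∃ c : ℝ, 0 < c ∧ v = c • rayGenerator r t.a t.b t.ℓ) ∨
     (t.b = t.a ∧ t.ℓ = t.a ∧ ∃ l < t.a, ∃ c : ℝ, 0 < c ∧ v = c • rayGenerator r t.a t.a l))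

/-- The set of all integers that occur as an entry of the label of a vertex of `F`. -/
def labelEntries (r : ℕ) (F : Set (KostkaSpace r)) : Set ℕ :=
  {n | ∃ v ∈ F.extremePoints ℝ, ∃ t : KostkaLabel, HasLabel r v t ∧ (n = t.a ∨ n = t.b ∨ n = t.ℓ)}

/-- A top-degree `d`-face: one whose vertex labels have `3d+3` distinct entries altogether. -/
def IsTopDegreeFace (r d : ℕ) (F : Set (KostkaSpace r)) : Prop :=
  F ∈ kostkaFaces r d ∧ (labelEntries r F).ncard = 3 * d + 3

/-- `v 0, …, v d` are vertices of the Kostka polytope with labels `(a i, b i, ℓ i)` satisfying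
`ℓ i < b i < a i`, and the intervals `[ℓ i, a i]` are pairwise disjoint. -/
def IsDisjointlyLabeled (r d : ℕ) (v : Fin (d + 1) → KostkaSpace r) : Prop :=
  ∃ t : Fin (d + 1) → KostkaLabel,
    (∀ i, HasLabel r (v i) (t i) ∧ (t i).ℓ < (t i).b ∧ (t i).b < (t i).a) ∧
    ∀ i j, i ≠ j → Disjoint (Set.Icc (t i).ℓ (t i).a) (Set.Icc (t j).ℓ (t j).a)

end

namespace Kostka

/-! The cone is cut out by three families of inequalities: the descents of `λ` and `μ` are
nonnegative, and so are the differences `D n` of partial sums, with `D r = 0`. They are tied by one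
relation: the second difference of `D` at `n` is the `n`-th descent of `μ` minus that of `λ`. At a
peak of `D` the tuple `λ` descends, and at a zero of `D` next to a positive value `μ` descends.
Hence every nonzero point has the strict inequalities of some labeled ray. Subtracting the largest
possible multiple of its generator and inducting shows that the labeled rays generate the cone
(`mem_span_gen`).

A face is therefore encoded by the set `A` of inequalities strict at a relative interior point, and
the sets that occur are the unions of supports of rays (`Facial`, `kostkaFaces_eq`). On the linear
span of such a face of the cone, the descents of `λ` in `A` and the descents of `μ` at indices where
dominance is strict are free coordinates: they determine `D` by a discrete Dirichlet problem, and
then all the rest. So the dimension in the cone is `weight A`, one more than in the polytope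
(`Facial.finrank_faceSpace`).

Being facial and having a given weight depend only on the relative order of the indices. Sorting
faces by their index set gives `f_d(r) = ∑ k, α k * C(r, k)`, where `α k` counts facial sets of
weight `d + 1` with index set `{1, …, k}` (`ncard_facialUpTo`).

For the degree, a label entry is a descent index of `λ`, a descent index of `μ` inside a strict
dominance interval, or a left or right end of such an interval. The two kinds of ends inject into
the descents of `λ`, so there are at most `3 * weight A` entries. Equality forces disjoint label
intervals, and on `{1, …, 3d+3}` only the triples of consecutive integers remain, so the top
coefficient is one. -/

/-- The three families of inequalities that cut out the Kostka cone: `lam n` and `mu n` say that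
the `n`-th descents of the two tuples are nonnegative, `dom n` compares the sums of the first `n`
parts. -/
inductive Facet : Type
  | lam (n : ℕ) : Facet
  | mu (n : ℕ) : Facet
  | dom (n : ℕ) : Facet

/-! ### Labels, supports of rays and facial sets -/

/-- The labels with `ℓ < b < a`. -/
def Proper (t : KostkaLabel) : Prop := t.ℓ < t.b ∧ t.b < t.a

/-- The triples that label a ray. -/
def Valid (t : KostkaLabel) : Prop := Proper t ∨ (t.b = t.a ∧ t.ℓ = t.a ∧ 0 < t.a)

/-- The inequalities that are strict on the ray labeled by `t`. -/
def labelSupport (t : KostkaLabel) : Set Facet :=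
  {f | match f with
    | .lam n => n = t.b
    | .mu n => 0 < n ∧ (n = t.a ∨ n = t.ℓ)
    | .dom n => t.ℓ < n ∧ n < t.a}

@[simp] theorem lam_mem_labelSupport {t : KostkaLabel} {n : ℕ} :
    Facet.lam n ∈ labelSupport t ↔ n = t.b := Iff.rfl

@[simp] theorem mu_mem_labelSupport {t : KostkaLabel} {n : ℕ} :
    Facet.mu n ∈ labelSupport t ↔ 0 < n ∧ (n = t.a ∨ n = t.ℓ) := Iff.rfl

@[simp] theorem dom_mem_labelSupport {t : KostkaLabel} {n : ℕ} :
    Facet.dom n ∈ labelSupport t ↔ t.ℓ < n ∧ n < t.a := Iff.rfl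

/-- The indices `n` with `lam n ∈ A`. -/
def lamIdx (A : Set Facet) : Set ℕ := {n | Facet.lam n ∈ A}

/-- The indices `n` with `mu n ∈ A` and `dom n ∈ A`. -/
def innerMuIdx (A : Set Facet) : Set ℕ := {n | Facet.mu n ∈ A ∧ Facet.dom n ∈ A}

/-- The dimension of the face of the cone that has support `A`. -/
noncomputable def weight (A : Set Facet) : ℕ := (lamIdx A).ncard + (innerMuIdx A).ncard

/-- The indices `n` with `lam n ∈ A` or `mu n ∈ A`. -/
def indices (A : Set Facet) : Set ℕ := {n | Facet.lam n ∈ A ∨ Facet.mu n ∈ A}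

/-- The labels of the rays whose support is contained in `A`. -/
def labels (A : Set Facet) : Set KostkaLabel := {t | Valid t ∧ labelSupport t ⊆ A}

/-- The entries of the labels in `labels A`. -/
def labelValues (A : Set Facet) : Set ℕ := {n | ∃ t ∈ labels A, n = t.a ∨ n = t.b ∨ n = t.ℓ}

/-- A set of inequalities is facial if it is a union of supports of rays. -/
def Facial (A : Set Facet) : Prop := ∀ f ∈ A, ∃ t ∈ labels A, f ∈ labelSupport t

theorem Valid.pos_b {t : KostkaLabel} (h : Valid t) : 0 < t.b := by
  rcases h with h | h
  · exact lt_of_le_of_lt (Nat.zero_le _) h.1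
  · omega

theorem Valid.pos_a {t : KostkaLabel} (h : Valid t) : 0 < t.a := by
  rcases h with h | h
  · exact lt_of_le_of_lt (Nat.zero_le _) h.2
  · omega

theorem Valid.le_a {t : KostkaLabel} (h : Valid t) : t.b ≤ t.a ∧ t.ℓ ≤ t.b := by
  rcases h with ⟨h1, h2⟩ | h <;> omega

section support

variable {A : Set Facet}

theorem lam_b_mem {t : KostkaLabel} (h : t ∈ labels A) : Facet.lam t.b ∈ A := h.2 rfl

theorem mu_a_mem {t : KostkaLabel} (h : t ∈ labels A) : Facet.mu t.a ∈ A :=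
  h.2 ⟨h.1.pos_a, Or.inl rfl⟩

theorem mu_l_mem {t : KostkaLabel} (h : t ∈ labels A) (h0 : 0 < t.ℓ) :
    Facet.mu t.ℓ ∈ A :=
  h.2 ⟨h0, Or.inr rfl⟩

theorem dom_mem {t : KostkaLabel} (h : t ∈ labels A) {n : ℕ} (h1 : t.ℓ < n)
    (h2 : n < t.a) : Facet.dom n ∈ A :=
  h.2 ⟨h1, h2⟩

theorem Facial.not_dom_zero (hA : Facial A) : Facet.dom 0 ∉ A := fun h => by
  obtain ⟨t, -, h1, -⟩ := hA _ h
  omega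

theorem Facial.pos_of_mem_indices (hA : Facial A) {n : ℕ} (hn : n ∈ indices A) : 0 < n := by
  rcases hn with h | h
  · obtain ⟨t, ht, h1⟩ := hA _ h
    rw [lam_mem_labelSupport] at h1
    exact h1 ▸ ht.1.pos_b
  · obtain ⟨t, ht, h1⟩ := hA _ h
    exact h1.1

theorem a_mem_indices {t : KostkaLabel} (h : t ∈ labels A) : t.a ∈ indices A :=
  Or.inr (mu_a_mem h)

theorem b_mem_indices {t : KostkaLabel} (h : t ∈ labels A) : t.b ∈ indices A :=
  Or.inl (lam_b_mem h)

theorem l_mem_indices {t : KostkaLabel} (h : t ∈ labels A) (h0 : 0 < t.ℓ) :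
    t.ℓ ∈ indices A :=
  Or.inr (mu_l_mem h h0)

theorem Facial.indices_subset_labelValues (hA : Facial A) : indices A ⊆ labelValues A := by
  rintro n (h | h)
  · obtain ⟨t, ht, h1⟩ := hA _ h
    exact ⟨t, ht, Or.inr (Or.inl h1)⟩
  · obtain ⟨t, ht, -, h1⟩ := hA _ h
    exact ⟨t, ht, by tauto⟩

theorem labelValues_subset : labelValues A ⊆ insert 0 (indices A) := by
  rintro n ⟨t, ht, rfl | rfl | rfl⟩
  · exact Or.inr (a_mem_indices ht)
  · exact Or.inr (b_mem_indices ht)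
  · rcases Nat.eq_zero_or_pos t.ℓ with h | h
    · exact Or.inl h
    · exact Or.inr (l_mem_indices ht h)

theorem finite_labelValues (h : (indices A).Finite) : (labelValues A).Finite :=
  (h.insert 0).subset labelValues_subset

theorem finite_lamIdx (h : (indices A).Finite) : (lamIdx A).Finite :=
  h.subset fun _ hn => Or.inl hn

theorem finite_innerMuIdx (h : (indices A).Finite) : (innerMuIdx A).Finite :=
  h.subset fun _ hn => Or.inr hn.1

/-! ### Bounding the number of label entries -/

/-- Left ends of the intervals on which the dominance inequalities of `A` are strict. -/
def leftEnds (A : Set Facet) : Set ℕ :=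
  {z | Facet.dom z ∉ A ∧ ∃ t ∈ labels A, Proper t ∧ z = t.ℓ}

/-- Right ends of the intervals on which the dominance inequalities of `A` are strict. -/
def rightEnds (A : Set Facet) : Set ℕ :=
  {z | Facet.dom z ∉ A ∧ ∃ t ∈ labels A, Proper t ∧ z = t.a}

/-- The first index of `lamIdx A` after `z`. -/
noncomputable def nextLam (A : Set Facet) (z : ℕ) : ℕ := sInf {b | Facet.lam b ∈ A ∧ z < b}

/-- The last index of `lamIdx A` before `z`. -/
noncomputable def prevLam (A : Set Facet) (z : ℕ) : ℕ := sSup {b | Facet.lam b ∈ A ∧ b < z}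

theorem nextLam_spec {t : KostkaLabel} (ht : t ∈ labels A) (hp : Proper t) :
    Facet.lam (nextLam A t.ℓ) ∈ A ∧ t.ℓ < nextLam A t.ℓ ∧ nextLam A t.ℓ ≤ t.b := by
  have hb : t.b ∈ {b | Facet.lam b ∈ A ∧ t.ℓ < b} := ⟨(lam_b_mem ht), hp.1⟩
  have h := Nat.sInf_mem ⟨_, hb⟩
  exact ⟨h.1, h.2, Nat.sInf_le hb⟩

theorem prevLam_spec {t : KostkaLabel} (ht : t ∈ labels A) (hp : Proper t) :
    Facet.lam (prevLam A t.a) ∈ A ∧ prevLam A t.a < t.a ∧ t.b ≤ prevLam A t.a := by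
  have hb : t.b ∈ {b | Facet.lam b ∈ A ∧ b < t.a} := ⟨(lam_b_mem ht), hp.2⟩
  have hbd : BddAbove {b | Facet.lam b ∈ A ∧ b < t.a} := ⟨t.a, fun x hx => hx.2.le⟩
  have h := Nat.sSup_mem ⟨_, hb⟩ hbd
  exact ⟨h.1, h.2, le_csSup hbd hb⟩

/-- If left ends `ℓ < ℓ'` had the same next index in `lamIdx A`, then `ℓ'` would lie strictly inside
the label interval starting at `ℓ`, making dominance strict at `ℓ'`. Right ends are treated by the
mirror argument. -/
theorem nextLam_injOn : Set.InjOn (nextLam A) (leftEnds A) := by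
  rintro _ ⟨hz, t, ht, hp, rfl⟩ _ ⟨hz', t', ht', hp', rfl⟩ h
  obtain ⟨-, h1, h2⟩ := nextLam_spec ht hp
  obtain ⟨-, h1', h2'⟩ := nextLam_spec ht' hp'
  have := hp.2
  have := hp'.2
  rcases lt_trichotomy t.ℓ t'.ℓ with hlt | heq | hlt
  · exact absurd (dom_mem ht hlt (by omega)) hz'
  · exact heq
  · exact absurd (dom_mem ht' hlt (by omega)) hz

theorem prevLam_injOn : Set.InjOn (prevLam A) (rightEnds A) := by
  rintro _ ⟨hz, t, ht, hp, rfl⟩ _ ⟨hz', t', ht', hp', rfl⟩ h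
  obtain ⟨-, h1, h2⟩ := prevLam_spec ht hp
  obtain ⟨-, h1', h2'⟩ := prevLam_spec ht' hp'
  have := hp.1
  have := hp'.1
  rcases lt_trichotomy t.a t'.a with hlt | heq | hlt
  · exact absurd (dom_mem ht' (by omega) hlt) hz
  · exact heq
  · exact absurd (dom_mem ht (by omega) hlt) hz'

theorem ncard_leftEnds_le (hf : (indices A).Finite) : (leftEnds A).ncard ≤ (lamIdx A).ncard := by
  refine Set.ncard_le_ncard_of_injOn (nextLam A) ?_ nextLam_injOn (finite_lamIdx hf)
  rintro _ ⟨-, t, ht, hp, rfl⟩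
  exact (nextLam_spec ht hp).1

theorem ncard_rightEnds_le (hf : (indices A).Finite) :
    (rightEnds A).ncard ≤ (lamIdx A).ncard := by
  refine Set.ncard_le_ncard_of_injOn (prevLam A) ?_ prevLam_injOn (finite_lamIdx hf)
  rintro _ ⟨-, t, ht, hp, rfl⟩
  exact (prevLam_spec ht hp).1

/-- The entries `a` and `ℓ > 0` always carry a strict `mu` inequality. If dominance is strict there
too they are inner, and otherwise they are ends. The entry `ℓ = 0` is a left end, since the form
`dom 0` vanishes on every ray. -/
theorem Facial.labelValues_subset_union (hA : Facial A) :
    labelValues A ⊆ lamIdx A ∪ innerMuIdx A ∪ (leftEnds A ∪ rightEnds A) := by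
  rintro n ⟨t, ht, hn⟩
  rcases ht.1 with hp | hd
  · rcases hn with rfl | rfl | rfl
    · by_cases h : Facet.dom t.a ∈ A
      · exact Or.inl (Or.inr ⟨(mu_a_mem ht), h⟩)
      · exact Or.inr (Or.inr ⟨h, t, ht, hp, rfl⟩)
    · exact Or.inl (Or.inl (lam_b_mem ht))
    · by_cases h : Facet.dom t.ℓ ∈ A
      · refine Or.inl (Or.inr ⟨mu_l_mem ht ?_, h⟩)
        rcases Nat.eq_zero_or_pos t.ℓ with h0 | h0
        · exact absurd (h0 ▸ h) hA.not_dom_zero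
        · exact h0
      · exact Or.inr (Or.inl ⟨h, t, ht, hp, rfl⟩)
  · have : n = t.b := by omega
    exact Or.inl (Or.inl (this ▸ (lam_b_mem ht)))

theorem finite_leftEnds (hf : (indices A).Finite) : (leftEnds A).Finite :=
  (finite_labelValues hf).subset fun _ ⟨_, t, ht, _, hz⟩ => ⟨t, ht, by tauto⟩

theorem finite_rightEnds (hf : (indices A).Finite) : (rightEnds A).Finite :=
  (finite_labelValues hf).subset fun _ ⟨_, t, ht, _, hz⟩ => ⟨t, ht, by tauto⟩

theorem Facial.ncard_labelValues_le_add (hA : Facial A) (hf : (indices A).Finite) :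
    (labelValues A).ncard ≤
      (lamIdx A).ncard + (innerMuIdx A).ncard + (leftEnds A ∪ rightEnds A).ncard := by
  refine (Set.ncard_le_ncard hA.labelValues_subset_union (((finite_lamIdx hf).union
    (finite_innerMuIdx hf)).union ((finite_leftEnds hf).union (finite_rightEnds hf)))).trans ?_
  refine (Set.ncard_union_le _ _).trans ?_
  gcongr
  exact Set.ncard_union_le _ _

theorem Facial.ncard_labelValues_le (hA : Facial A) (hf : (indices A).Finite) :
    (labelValues A).ncard ≤ 3 * weight A := by
  have h1 := hA.ncard_labelValues_le_add hf
  have h2 := Set.ncard_union_le (leftEnds A) (rightEnds A)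
  have h3 := ncard_leftEnds_le hf
  have h4 := ncard_rightEnds_le hf
  unfold weight
  omega

/-! ### The extremal case: separated labels -/

/-- A set of labels is separated if its members are proper and the intervals `[ℓ, a]` are pairwise
disjoint. -/
def Separated (T : Set KostkaLabel) : Prop :=
  (∀ t ∈ T, Proper t) ∧
    ∀ t ∈ T, ∀ t' ∈ T, t ≠ t' → Disjoint (Set.Icc t.ℓ t.a) (Set.Icc t'.ℓ t'.a)

theorem Separated.eq_of_mem {T : Set KostkaLabel} (hT : Separated T) {t t' : KostkaLabel}
    (ht : t ∈ T) (ht' : t' ∈ T) {n : ℕ} (h1 : t.ℓ ≤ n) (h2 : n ≤ t.a) (h3 : t'.ℓ ≤ n)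
    (h4 : n ≤ t'.a) : t = t' := by
  by_contra h
  exact Set.disjoint_left.1 (hT.2 t ht t' ht' h) ⟨h1, h2⟩ ⟨h3, h4⟩

/-- If the labels of a facial set have as many entries as possible, they are separated, and their
number is the weight. -/
theorem Facial.separated_labels (hA : Facial A) (hf : (indices A).Finite)
    (h : 3 * weight A ≤ (labelValues A).ncard) :
    Separated (labels A) ∧ (labels A).ncard = weight A := by
  have h1 := hA.ncard_labelValues_le_add hf
  have h2 := Set.ncard_union_add_ncard_inter (leftEnds A) (rightEnds A)
    (finite_leftEnds hf) (finite_rightEnds hf)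
  have h3 := ncard_leftEnds_le hf
  have h4 := ncard_rightEnds_le hf
  unfold weight at h
  -- The bound is `3 * |lamIdx| + |innerMuIdx| - |leftEnds ∩ rightEnds|` at most, so equality with
  -- three times the weight kills the last two terms and makes both injections into `lamIdx A`
  -- bijective.
  have hinner : innerMuIdx A = ∅ :=
    (Set.ncard_eq_zero (finite_innerMuIdx hf)).1 (by omega)
  have hinter : leftEnds A ∩ rightEnds A = ∅ :=
    (Set.ncard_eq_zero ((finite_leftEnds hf).subset Set.inter_subset_left)).1 (by omega)
  have hno : ∀ n, Facet.mu n ∈ A → Facet.dom n ∈ A → False := fun n hn hn' => by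
    have : n ∈ innerMuIdx A := ⟨hn, hn'⟩
    rw [hinner] at this
    exact this
  have hda : ∀ t ∈ labels A, Facet.dom t.a ∉ A := fun t ht hd => hno _ (mu_a_mem ht) hd
  have hdl : ∀ t ∈ labels A, Facet.dom t.ℓ ∉ A := fun t ht hd => by
    rcases Nat.eq_zero_or_pos t.ℓ with h0 | h0
    · exact hA.not_dom_zero (h0 ▸ hd)
    · exact hno _ (mu_l_mem ht h0) hd
  have himg : nextLam A '' leftEnds A = lamIdx A := by
    refine Set.eq_of_subset_of_ncard_le ?_ ?_ (finite_lamIdx hf)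
    · rintro _ ⟨_, ⟨-, t, ht, hp, rfl⟩, rfl⟩
      exact (nextLam_spec ht hp).1
    · rw [nextLam_injOn.ncard_image]
      omega
  have hsurj : ∀ b, Facet.lam b ∈ A → ∃ t ∈ labels A, Proper t ∧ b = nextLam A t.ℓ ∧
      t.ℓ < b ∧ b < t.a := fun b hb => by
    have : b ∈ nextLam A '' leftEnds A := himg ▸ hb
    obtain ⟨_, ⟨-, t, ht, hp, rfl⟩, rfl⟩ := this
    obtain ⟨-, h5, h6⟩ := nextLam_spec ht hp
    exact ⟨t, ht, hp, rfl, h5, lt_of_le_of_lt h6 hp.2⟩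
  -- A label `(a, a, a)` would put the descent index `a` of `μ` inside the dominance interval found
  -- by `hsurj`, against `hinner`.
  have hprop : ∀ t ∈ labels A, Proper t := fun t ht => by
    rcases ht.1 with hp | hd
    · exact hp
    · obtain ⟨t', ht', -, -, h5, h6⟩ := hsurj _ (lam_b_mem ht)
      exact absurd (hd.1 ▸ dom_mem ht' h5 h6) (hda t ht)
  -- Both `t` and the label `t'` supplied by `hsurj` have `t.b` strictly inside their intervals, so
  -- different left ends would place one of them strictly inside the other interval.
  have hb : ∀ t ∈ labels A, t.b = nextLam A t.ℓ := fun t ht => by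
    obtain ⟨t', ht', -, h5, h6, h7⟩ := hsurj _ (lam_b_mem ht)
    obtain ⟨h8, h9⟩ := hprop t ht
    rcases lt_trichotomy t.ℓ t'.ℓ with hlt | heq | hlt
    · exact absurd (dom_mem ht hlt (by omega)) (hdl _ ht')
    · rwa [heq]
    · exact absurd (dom_mem ht' hlt (by omega)) (hdl _ ht)
  have hends : ∀ t ∈ labels A, ∀ t' ∈ labels A, t.a ≠ t'.ℓ := fun t ht t' ht' he => by
    have : t.a ∈ leftEnds A ∩ rightEnds A :=
      ⟨⟨hda t ht, t', ht', hprop _ ht', he⟩, ⟨hda t ht, t, ht, hprop _ ht, rfl⟩⟩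
    rw [hinter] at this
    exact this
  -- No end lies strictly inside a label interval, and left ends differ from right ends, so
  -- overlapping intervals coincide; `hb` then recovers `b` from `ℓ`.
  have hsep : Separated (labels A) := by
    refine ⟨hprop, fun t ht t' ht' hne => ?_⟩
    rw [Set.disjoint_left]
    rintro n ⟨h5, h6⟩ ⟨h5', h6'⟩
    have e1 := hends t ht t' ht'
    have e2 := hends t' ht' t ht
    have el : t.ℓ = t'.ℓ := by
      rcases lt_trichotomy t.ℓ t'.ℓ with hlt | heq | hlt
      · exact absurd (dom_mem ht hlt (by omega)) (hdl _ ht')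
      · exact heq
      · exact absurd (dom_mem ht' hlt (by omega)) (hdl _ ht)
    have ea : t.a = t'.a := by
      rcases lt_trichotomy t.a t'.a with hlt | heq | hlt
      · exact absurd (dom_mem ht' (by omega) hlt) (hda _ ht)
      · exact heq
      · exact absurd (dom_mem ht (by omega) hlt) (hda _ ht')
    exact hne (KostkaLabel.ext ea (by rw [hb t ht, hb t' ht', el]) el)
  refine ⟨hsep, ?_⟩
  unfold weight
  rw [hinner, Set.ncard_empty, add_zero]
  refine Set.BijOn.ncard_eq (f := KostkaLabel.b) ⟨fun t ht => (lam_b_mem ht), ?_, ?_⟩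
  · intro t ht t' ht' he
    obtain ⟨h5, h6⟩ := hprop t ht
    obtain ⟨h5', h6'⟩ := hprop t' ht'
    exact hsep.eq_of_mem ht ht' h5.le h6.le (by omega) (by omega)
  · intro b hb'
    obtain ⟨t, ht, h5⟩ := hA _ hb'
    exact ⟨t, ht, h5.symm⟩

/-- The union of the supports of the labels in `T`. -/
def supportUnion (T : Set KostkaLabel) : Set Facet := ⋃ t ∈ T, labelSupport t

theorem mem_supportUnion {T : Set KostkaLabel} {f : Facet} :
    f ∈ supportUnion T ↔ ∃ t ∈ T, f ∈ labelSupport t := by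
  simp [supportUnion]

theorem facial_supportUnion {T : Set KostkaLabel} (hT : ∀ t ∈ T, Valid t) :
    Facial (supportUnion T) := fun f hf => by
  obtain ⟨t, ht, hft⟩ := mem_supportUnion.1 hf
  exact ⟨t, ⟨hT t ht, fun g hg => mem_supportUnion.2 ⟨t, ht, hg⟩⟩, hft⟩

theorem Facial.supportUnion_labels (hA : Facial A) : supportUnion (labels A) = A := by
  ext f
  rw [mem_supportUnion]
  exact ⟨fun ⟨t, ht, hf⟩ => ht.2 hf, hA f⟩

/-- No further ray lies in the face. The index `b` of such a ray picks a member of `T`; the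
dominance interval cannot cross the ends of that member's interval, as no interval of `T` covers
them in its interior. The `mu` inequalities then force the same ends. -/
theorem Separated.labels_supportUnion {T : Set KostkaLabel} (hT : Separated T) :
    labels (supportUnion T) = T := by
  refine Set.Subset.antisymm ?_ fun t ht =>
    ⟨Or.inl (hT.1 t ht), fun g hg => mem_supportUnion.2 ⟨t, ht, hg⟩⟩
  intro t ht
  obtain ⟨ti, hti, hb⟩ := mem_supportUnion.1 (lam_b_mem ht)
  rw [lam_mem_labelSupport] at hb
  obtain ⟨hi1, hi2⟩ := hT.1 ti hti
  obtain ⟨tj, htj, -, ha⟩ := mem_supportUnion.1 (mu_a_mem ht)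
  have hj := hT.1 tj htj
  unfold Proper at hj
  have hdom : ∀ n, t.ℓ < n → n < t.a → ∃ s ∈ T, s.ℓ < n ∧ n < s.a := fun n h1 h2 =>
    mem_supportUnion.1 (dom_mem ht h1 h2)
  rcases ht.1 with ⟨hp1, hp2⟩ | hd
  · have ha_le : t.a ≤ ti.a := by
      by_contra hlt
      obtain ⟨s, hs, h1, h2⟩ := hdom ti.a (by omega) (by omega)
      have := hT.eq_of_mem hs hti h1.le h2.le (by omega) le_rfl
      subst this
      omega
    have hl_le : ti.ℓ ≤ t.ℓ := by
      by_contra hlt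
      obtain ⟨s, hs, h1, h2⟩ := hdom ti.ℓ (by omega) (by omega)
      have := hT.eq_of_mem hs hti h1.le h2.le le_rfl (by omega)
      subst this
      omega
    have hij := hT.eq_of_mem (n := t.a) hti htj (by omega) (by omega) (by omega) (by omega)
    subst hij
    have hl : t.ℓ = ti.ℓ := by
      rcases Nat.eq_zero_or_pos t.ℓ with h0 | h0
      · omega
      · obtain ⟨tk, htk, -, hl⟩ := mem_supportUnion.1 (mu_l_mem ht h0)
        have hk := hT.1 tk htk
        unfold Proper at hk
        have hik := hT.eq_of_mem (n := t.ℓ) hti htk (by omega) (by omega) (by omega) (by omega)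
        subst hik
        omega
    have : t = ti := KostkaLabel.ext (by omega) hb hl
    exact this ▸ hti
  · have hij := hT.eq_of_mem (n := t.a) hti htj (by omega) (by omega) (by omega) (by omega)
    subst hij
    omega

/-- Disjointness keeps every end of an interval outside the interiors of all intervals, so there are
no inner `mu` indices, and `b` counts the labels. -/
theorem Separated.weight_supportUnion {T : Set KostkaLabel} (hT : Separated T) :
    weight (supportUnion T) = T.ncard := by
  have hinner : innerMuIdx (supportUnion T) = ∅ := by
    rw [Set.eq_empty_iff_forall_notMem]
    rintro n ⟨h1, h2⟩
    obtain ⟨t, ht, -, h3⟩ := mem_supportUnion.1 h1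
    obtain ⟨s, hs, h4, h5⟩ := mem_supportUnion.1 h2
    have hp := hT.1 t ht
    unfold Proper at hp
    have := hT.eq_of_mem (n := n) ht hs (by omega) (by omega) h4.le h5.le
    subst this
    omega
  unfold weight
  rw [hinner, Set.ncard_empty, add_zero]
  symm
  refine Set.BijOn.ncard_eq (f := KostkaLabel.b) ⟨?_, ?_, ?_⟩
  · exact fun t ht => mem_supportUnion.2 ⟨t, ht, rfl⟩
  · intro t ht t' ht' he
    obtain ⟨h5, h6⟩ := hT.1 t ht
    obtain ⟨h5', h6'⟩ := hT.1 t' ht'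
    exact hT.eq_of_mem ht ht' h5.le h6.le (by omega) (by omega)
  · intro b hb'
    obtain ⟨t, ht, h5⟩ := mem_supportUnion.1 hb'
    exact ⟨t, ht, h5.symm⟩

theorem Separated.ncard_labelValues {T : Set KostkaLabel} (hT : Separated T) :
    (labelValues (supportUnion T)).ncard = 3 * T.ncard := by
  let g : KostkaLabel × Fin 3 → ℕ := fun x => ![x.1.a, x.1.b, x.1.ℓ] x.2
  have himg : labelValues (supportUnion T) = g '' (T ×ˢ Set.univ) := by
    ext n
    unfold labelValues
    rw [hT.labels_supportUnion]
    constructor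
    · rintro ⟨t, ht, h | h | h⟩
      · exact ⟨(t, 0), ⟨ht, trivial⟩, h.symm⟩
      · exact ⟨(t, 1), ⟨ht, trivial⟩, h.symm⟩
      · exact ⟨(t, 2), ⟨ht, trivial⟩, h.symm⟩
    · rintro ⟨⟨t, i⟩, ⟨ht, -⟩, rfl⟩
      refine ⟨t, ht, ?_⟩
      fin_cases i <;> simp [g]
  have hmem : ∀ x : KostkaLabel × Fin 3, x.1 ∈ T → x.1.ℓ ≤ g x ∧ g x ≤ x.1.a := by
    rintro ⟨t, i⟩ ht
    obtain ⟨h1, h2⟩ := hT.1 t ht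
    fin_cases i <;> simp [g] <;> omega
  have hinj : Set.InjOn g (T ×ˢ Set.univ) := by
    rintro ⟨t, i⟩ ⟨ht, -⟩ ⟨t', i'⟩ ⟨ht', -⟩ he
    have h1 := hmem (t, i) ht
    have h2 := hmem (t', i') ht'
    rw [← he] at h2
    have : t = t' := hT.eq_of_mem ht ht' h1.1 h1.2 h2.1 h2.2
    subst this
    obtain ⟨h3, h4⟩ := hT.1 t ht
    fin_cases i <;> fin_cases i' <;> simp [g] at he ⊢ <;> omega
  rw [himg, hinj.ncard_image, Set.ncard_prod, Set.ncard_univ]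
  simp [mul_comm]

end support

/-! ### Invariance under increasing relabelings of the indices -/

/-- Relabeling of the index of a facet. -/
def Facet.map (e : ℕ → ℕ) : Facet → Facet
  | .lam n => .lam (e n)
  | .mu n => .mu (e n)
  | .dom n => .dom (e n)

/-- Relabeling of the entries of a label. -/
def mapLabel (e : ℕ → ℕ) (t : KostkaLabel) : KostkaLabel := ⟨e t.a, e t.b, e t.ℓ⟩

section relabel

variable {A B : Set Facet} {e : ℕ → ℕ}

theorem map_mem_labelSupport_mapLabel (he : StrictMono e) (h0 : e 0 = 0) {f : Facet}
    {t : KostkaLabel} : f.map e ∈ labelSupport (mapLabel e t) ↔ f ∈ labelSupport t := by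
  have hpos : ∀ n, 0 < e n ↔ 0 < n := fun n => by
    simpa [h0] using he.lt_iff_lt (a := 0) (b := n)
  cases f <;>
    simp [Facet.map, mapLabel, he.lt_iff_lt, he.injective.eq_iff, hpos]

theorem valid_mapLabel (he : StrictMono e) (h0 : e 0 = 0) {t : KostkaLabel} :
    Valid (mapLabel e t) ↔ Valid t := by
  have hpos : ∀ n, 0 < e n ↔ 0 < n := fun n => by
    simpa [h0] using he.lt_iff_lt (a := 0) (b := n)
  simp [Valid, Proper, mapLabel, he.lt_iff_lt, he.injective.eq_iff, hpos]

theorem exists_eq_mapLabel (h0 : e 0 = 0) (hE : indices A ⊆ Set.range e) {t : KostkaLabel}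
    (ht : t ∈ labels A) : ∃ s, mapLabel e s = t := by
  obtain ⟨x, hx⟩ := hE (a_mem_indices ht)
  obtain ⟨y, hy⟩ := hE (b_mem_indices ht)
  have hl : ∃ z, e z = t.ℓ := by
    rcases Nat.eq_zero_or_pos t.ℓ with h | h
    · exact ⟨0, by rw [h0, h]⟩
    · exact hE (l_mem_indices ht h)
  obtain ⟨z, hz⟩ := hl
  exact ⟨⟨x, y, z⟩, KostkaLabel.ext hx hy hz⟩

theorem mem_labels_preimage (he : StrictMono e) (h0 : e 0 = 0) {s : KostkaLabel}
    (hs : mapLabel e s ∈ labels A) : s ∈ labels (Facet.map e ⁻¹' A) :=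
  ⟨(valid_mapLabel he h0).1 hs.1, fun _ hf =>
    hs.2 ((map_mem_labelSupport_mapLabel he h0).2 hf)⟩

theorem Facial.preimage (hA : Facial A) (he : StrictMono e) (h0 : e 0 = 0)
    (hE : indices A ⊆ Set.range e) : Facial (Facet.map e ⁻¹' A) := fun f hf => by
  obtain ⟨t, ht, hft⟩ := hA _ hf
  obtain ⟨s, rfl⟩ := exists_eq_mapLabel h0 hE ht
  exact ⟨s, mem_labels_preimage he h0 ht, (map_mem_labelSupport_mapLabel he h0).1 hft⟩

theorem indices_preimage : indices (Facet.map e ⁻¹' A) = e ⁻¹' indices A := rfl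

theorem weight_preimage (he : Function.Injective e) (hE : indices A ⊆ Set.range e) :
    weight (Facet.map e ⁻¹' A) = weight A := by
  have h1 : lamIdx (Facet.map e ⁻¹' A) = e ⁻¹' lamIdx A := rfl
  have h2 : innerMuIdx (Facet.map e ⁻¹' A) = e ⁻¹' innerMuIdx A := rfl
  rw [weight, weight, h1, h2,
    Set.ncard_preimage_of_injective_subset_range he (s := lamIdx A) fun n hn => hE (Or.inl hn),
    Set.ncard_preimage_of_injective_subset_range he (s := innerMuIdx A)
      fun n hn => hE (Or.inr hn.1)]

/-- In a facial set, the strict dominance inequalities at the indices determine all others. -/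
theorem Facial.dom_mem_of_indices (hA : Facial A) (hB : Facial B)
    (hAB : indices A = indices B)
    (h : ∀ n ∈ indices A, Facet.dom n ∈ A → Facet.dom n ∈ B) {k : ℕ} (hk : Facet.dom k ∈ A) :
    Facet.dom k ∈ B := by
  classical
  by_cases hkA : k ∈ indices A
  · exact h k hkA hk
  obtain ⟨t, ht, h1, h2⟩ := hA _ hk
  rcases ht.1 with ⟨hp1, hp2⟩ | hd
  swap
  · omega
  have hbA := b_mem_indices ht
  have hbk : t.b ≠ k := fun hb => hkA (hb ▸ hbA)
  rcases lt_or_gt_of_ne hbk with hlt | hlt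
  -- Move from `k` towards `t.b` to the nearest index `n`. The label of `B` whose interval contains
  -- `n` has its right end at an index, and no index lies in `(n, k]`, so the interval contains `k`
  -- as well. The other case is symmetric.
  · set n := Nat.findGreatest (· ∈ indices A) k with hn
    have hn1 : n ∈ indices A := Nat.findGreatest_spec (P := (· ∈ indices A)) hlt.le hbA
    have hn2 : t.b ≤ n := Nat.le_findGreatest hlt.le hbA
    have hn3 : n ≤ k := Nat.findGreatest_le k
    obtain ⟨s, hs, h3, h4⟩ := hB _ (h n hn1 (dom_mem ht (by omega) (by omega)))
    refine dom_mem hs (by omega) ?_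
    by_contra hle
    have hsa : s.a ∈ indices A := hAB ▸ a_mem_indices hs
    have : s.a ≤ n := Nat.le_findGreatest (by omega) hsa
    omega
  · have hex : ∃ n, n ∈ indices A ∧ k < n := ⟨t.b, hbA, hlt⟩
    obtain ⟨hn1, hn2⟩ := Nat.find_spec hex
    have hn3 : Nat.find hex ≤ t.b := Nat.find_min' hex ⟨hbA, hlt⟩
    obtain ⟨s, hs, h3, h4⟩ := hB _ (h _ hn1 (dom_mem ht (by omega) (by omega)))
    refine dom_mem hs ?_ (by omega)
    by_contra hle
    have hsl : s.ℓ ∈ indices A := hAB ▸ l_mem_indices hs (by omega)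
    have hne : s.ℓ ≠ k := fun hs' => hkA (hs' ▸ hsl)
    have := Nat.find_min' hex ⟨hsl, by omega⟩
    omega

/-- The preimage under `e` forgets the dominance inequalities outside the range of `e`; facial sets
lose nothing, because `Facial.dom_mem_of_indices` recovers them. -/
theorem Facial.subset_of_preimage_subset (hA : Facial A) (hB : Facial B)
    (hAB : indices A = indices B) (hE : indices A ⊆ Set.range e)
    (h : Facet.map e ⁻¹' A ⊆ Facet.map e ⁻¹' B) : A ⊆ B := by
  rintro (n | n | n) hn
  · obtain ⟨m, rfl⟩ := hE (Or.inl hn)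
    exact h (a := Facet.lam m) hn
  · obtain ⟨m, rfl⟩ := hE (Or.inr hn)
    exact h (a := Facet.mu m) hn
  · refine hA.dom_mem_of_indices hB hAB (fun n hn hn' => ?_) hn
    obtain ⟨m, rfl⟩ := hE hn
    exact h (a := Facet.dom m) hn'

/-- The facial sets of weight `d + 1` with a given set of indices. -/
def facialWith (d : ℕ) (E : Set ℕ) : Set (Set Facet) :=
  {A | Facial A ∧ weight A = d + 1 ∧ indices A = E}

theorem bijOn_preimage_facialWith (he : StrictMono e) (h0 : e 0 = 0) (d : ℕ) (I : Set ℕ) :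
    Set.BijOn (fun A => Facet.map e ⁻¹' A) (facialWith d (e '' I)) (facialWith d I) := by
  refine ⟨?_, ?_, ?_⟩
  · rintro A ⟨hA, hw, hI⟩
    have hE : indices A ⊆ Set.range e := hI ▸ Set.image_subset_range e I
    refine ⟨hA.preimage he h0 hE, (weight_preimage he.injective hE).trans hw, ?_⟩
    rw [indices_preimage, hI, Set.preimage_image_eq _ he.injective]
  · rintro A ⟨hA, hw, hI⟩ B ⟨hB, hw', hI'⟩ h
    have hE : indices A ⊆ Set.range e := hI ▸ Set.image_subset_range e I
    have hE' : indices B ⊆ Set.range e := hI' ▸ Set.image_subset_range e I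
    exact Set.Subset.antisymm
      (hA.subset_of_preimage_subset hB (hI.trans hI'.symm) hE (Eq.subset h))
      (hB.subset_of_preimage_subset hA (hI'.trans hI.symm) hE' (Eq.subset (Eq.symm h)))
  · rintro B ⟨hB, hw, hI⟩
    -- The inverse transports labels rather than facets: the image of `B` itself would miss the
    -- dominance inequalities in the gaps of the range of `e`.
    set A := supportUnion (mapLabel e '' labels B) with hAdef
    have hA : Facial A := facial_supportUnion fun t ht => by
      obtain ⟨s, hs, rfl⟩ := ht
      exact (valid_mapLabel he h0).2 hs.1
    have hpre : Facet.map e ⁻¹' A = B := by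
      ext f
      rw [Set.mem_preimage, hAdef, mem_supportUnion]
      constructor
      · rintro ⟨_, ⟨s, hs, rfl⟩, hf⟩
        exact hs.2 ((map_mem_labelSupport_mapLabel he h0).1 hf)
      · intro hf
        obtain ⟨s, hs, hfs⟩ := hB f hf
        exact ⟨_, ⟨s, hs, rfl⟩, (map_mem_labelSupport_mapLabel he h0).2 hfs⟩
    have hind : indices A = e '' I := by
      rw [← hI]
      apply Set.Subset.antisymm
      · intro n hn
        have hn0 := hA.pos_of_mem_indices hn
        have hr : n ∈ Set.range e := by
          rcases hn with h | h
          · obtain ⟨_, ⟨s, hs, rfl⟩, hf⟩ := mem_supportUnion.1 h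
            exact ⟨s.b, hf.symm⟩
          · obtain ⟨_, ⟨s, hs, rfl⟩, -, hf | hf⟩ := mem_supportUnion.1 h
            · exact ⟨s.a, hf.symm⟩
            · exact ⟨s.ℓ, hf.symm⟩
        obtain ⟨m, rfl⟩ := hr
        refine ⟨m, ?_, rfl⟩
        rw [← hpre]
        exact hn
      · rintro _ ⟨m, hm, rfl⟩
        rw [← hpre] at hm
        exact hm
    have hE : indices A ⊆ Set.range e := hind ▸ Set.image_subset_range e I
    refine ⟨A, ⟨hA, ?_, hind⟩, hpre⟩
    rw [← weight_preimage he.injective hE, hpre, hw]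

end relabel

/-! ### Counting facial sets by their index sets -/

/-- The number of facial sets of weight `d + 1` with set of indices `{1, …, k}`. -/
noncomputable def facialCount (d k : ℕ) : ℕ := (facialWith d (Set.Icc 1 k)).ncard

theorem exists_strictMono_image_Icc (E : Finset ℕ) (hE : ∀ n ∈ E, 0 < n) :
    ∃ e : ℕ → ℕ, StrictMono e ∧ e 0 = 0 ∧ e '' Set.Icc 1 E.card = E := by
  classical
  -- Including `0` makes the enumeration start at `e 0 = 0`, and including everything above the
  -- maximum of `E` makes it infinite, hence strictly increasing on all of `ℕ`.
  let p : ℕ → Prop := fun n => n = 0 ∨ n ∈ E ∨ E.sup id < n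
  have hle : ∀ n ∈ E, n ≤ E.sup id := fun n hn => Finset.le_sup (f := id) hn
  have hinf : ({n | p n}).Infinite :=
    (Set.Ioi_infinite (E.sup id)).mono fun n hn => Or.inr (Or.inr hn)
  have hmono : StrictMono (Nat.nth p) := Nat.nth_strictMono hinf
  have hcount : ∀ n, p n → Nat.nth p (Nat.count p n) = n := fun n hn => Nat.nth_count hn
  have h0 : Nat.nth p 0 = 0 := by
    have := hcount 0 (Or.inl rfl)
    simpa using this
  have hbig : Nat.count p (E.sup id + 1) = E.card + 1 := by
    rw [Nat.count_eq_card_filter_range]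
    have : (Finset.range (E.sup id + 1)).filter p = insert 0 E := by
      ext n
      simp only [Finset.mem_filter, Finset.mem_range, Finset.mem_insert, p]
      constructor
      · rintro ⟨h1, h2 | h2 | h2⟩
        · exact Or.inl h2
        · exact Or.inr h2
        · omega
      · rintro (h | h)
        · exact ⟨by omega, Or.inl h⟩
        · exact ⟨Nat.lt_succ_of_le (hle n h), Or.inr (Or.inl h)⟩
    rw [this, Finset.card_insert_of_notMem fun h => lt_irrefl 0 (hE 0 h)]
  refine ⟨Nat.nth p, hmono, h0, ?_⟩
  ext n
  constructor
  · rintro ⟨m, ⟨hm1, hm2⟩, rfl⟩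
    have h1 : 0 < Nat.nth p m := by
      rw [← h0]
      exact hmono hm1
    have h2 : Nat.nth p m < E.sup id + 1 := Nat.nth_lt_of_lt_count (by omega)
    have h3 : p (Nat.nth p m) := Nat.nth_mem_of_infinite hinf m
    rcases h3 with h3 | h3 | h3
    · omega
    · exact h3
    · omega
  · intro hn
    have hpn : p n := Or.inr (Or.inl hn)
    refine ⟨Nat.count p n, ⟨?_, ?_⟩, hcount n hpn⟩
    · rw [Nat.one_le_iff_ne_zero]
      intro hz
      have := hcount n hpn
      rw [hz, h0] at this
      have := hE n hn
      omega
    · have h1 : Nat.count p n < Nat.count p (E.sup id + 1) :=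
        Nat.count_strict_mono hpn (Nat.lt_succ_of_le (hle n hn))
      omega

theorem ncard_facialWith (d : ℕ) (E : Finset ℕ) (hE : ∀ n ∈ E, 0 < n) :
    (facialWith d (E : Set ℕ)).ncard = facialCount d E.card := by
  obtain ⟨e, he, h0, himg⟩ := exists_strictMono_image_Icc E hE
  rw [← himg]
  exact (bijOn_preimage_facialWith he h0 d _).ncard_eq

/-- The facial sets of weight `d + 1` with indices in `{1, …, r}`. -/
def facialUpTo (d r : ℕ) : Set (Set Facet) :=
  {A | Facial A ∧ weight A = d + 1 ∧ indices A ⊆ Set.Icc 1 r}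

/-- The facets with index at most `r`. -/
def facetsUpTo (r : ℕ) : Set Facet :=
  Facet.lam '' Set.Iic r ∪ Facet.mu '' Set.Iic r ∪ Facet.dom '' Set.Iic r

theorem finite_facetsUpTo (r : ℕ) : (facetsUpTo r).Finite :=
  (((Set.finite_Iic r).image _).union ((Set.finite_Iic r).image _)).union
    ((Set.finite_Iic r).image _)

theorem Facial.subset_facetsUpTo {A : Set Facet} (hA : Facial A) {r : ℕ}
    (h : indices A ⊆ Set.Icc 1 r) : A ⊆ facetsUpTo r := by
  rintro (n | n | n) hn
  · exact Or.inl (Or.inl ⟨n, (h (Or.inl hn)).2, rfl⟩)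
  · exact Or.inl (Or.inr ⟨n, (h (Or.inr hn)).2, rfl⟩)
  · obtain ⟨t, ht, -, h2⟩ := hA _ hn
    exact Or.inr ⟨n, h2.le.trans (h (a_mem_indices ht)).2, rfl⟩

theorem finite_facialUpTo (d r : ℕ) : (facialUpTo d r).Finite :=
  (finite_facetsUpTo r).finite_subsets.subset fun _ hA => hA.1.subset_facetsUpTo hA.2.2

/-- Every index is a label entry, and there are at most `3 * (d + 1)` label entries. -/
theorem facialCount_eq_zero {d k : ℕ} (hk : 3 * d + 3 < k) : facialCount d k = 0 := by
  have : facialWith d (Set.Icc 1 k) = ∅ := by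
    rw [Set.eq_empty_iff_forall_notMem]
    rintro A ⟨hA, hw, hI⟩
    have hf : (indices A).Finite := hI ▸ Set.finite_Icc 1 k
    have h1 := hA.ncard_labelValues_le hf
    have h2 := Set.ncard_le_ncard hA.indices_subset_labelValues (finite_labelValues hf)
    rw [hI, ← Finset.coe_Icc, Set.ncard_coe_finset, Nat.card_Icc] at h2
    omega
  rw [facialCount, this, Set.ncard_empty]

theorem ncard_facialUpTo (d r : ℕ) :
    (facialUpTo d r).ncard = ∑ k ∈ Finset.range (3 * d + 4), facialCount d k * r.choose k := by
  classical
  have hmaps : Set.MapsTo (fun A : Set Facet => (Finset.Icc 1 r).filter (· ∈ indices A))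
      (finite_facialUpTo d r).toFinset (Finset.Icc 1 r).powerset := fun A _ => by
    exact Finset.mem_coe.2 (Finset.mem_powerset.2 (Finset.filter_subset _ _))
  have hfiber : ∀ E ∈ (Finset.Icc 1 r).powerset,
      ((finite_facialUpTo d r).toFinset.filter
        fun A => (Finset.Icc 1 r).filter (· ∈ indices A) = E).card = facialCount d E.card := by
    intro E hE
    rw [Finset.mem_powerset] at hE
    rw [← ncard_facialWith d E fun n hn => (Finset.mem_Icc.1 (hE hn)).1,
      ← Set.ncard_coe_finset]
    congr 1
    ext A
    simp only [Finset.coe_filter, Set.Finite.mem_toFinset, Set.mem_ofPred_eq, facialUpTo,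
      facialWith]
    constructor
    · rintro ⟨⟨h1, h2, h3⟩, rfl⟩
      refine ⟨h1, h2, ?_⟩
      ext n
      simp only [Finset.coe_filter, Set.mem_ofPred_eq, Finset.mem_Icc]
      exact ⟨fun h => ⟨h3 h, h⟩, fun h => h.2⟩
    · rintro ⟨h1, h2, h3⟩
      refine ⟨⟨h1, h2, fun n hn => ?_⟩, ?_⟩
      · rw [h3] at hn
        exact Finset.mem_Icc.1 (hE hn)
      · ext n
        rw [Finset.mem_filter, h3]
        exact ⟨fun h => h.2, fun h => ⟨hE h, h⟩⟩
  rw [Set.ncard_eq_toFinset_card _ (finite_facialUpTo d r),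
    Finset.card_eq_sum_card_fiberwise hmaps, Finset.sum_congr rfl hfiber,
    Finset.sum_powerset_apply_card, Nat.card_Icc, Nat.add_sub_cancel]
  simp only [smul_eq_mul, mul_comm (facialCount d _)]
  -- The sum over subsets stops at `r`, the claimed one at `3d+3`. Both extend to a common range, as
  -- `C(r, k)` vanishes for `k > r` and `facialCount d k` for `k > 3d+3`.
  have key : ∀ m, (∀ k, m ≤ k → r.choose k * facialCount d k = 0) → ∀ N, m ≤ N →
      ∑ k ∈ Finset.range m, r.choose k * facialCount d k =
        ∑ k ∈ Finset.range N, r.choose k * facialCount d k := fun m hm N hN =>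
    Finset.sum_subset (Finset.range_mono hN) fun k _ hk =>
      hm k (by simpa using hk)
  rw [key (r + 1) (fun k hk => by rw [Nat.choose_eq_zero_of_lt (by omega), zero_mul])
      (max (r + 1) (3 * d + 4)) (le_max_left _ _),
    key (3 * d + 4) (fun k hk => by rw [facialCount_eq_zero (by omega), mul_zero])
      (max (r + 1) (3 * d + 4)) (le_max_right _ _)]

/-! ### The top coefficient -/

/-- The labels `(3, 2, 1), (6, 5, 4), …`. -/
def consecutiveLabels (m : ℕ) : Set KostkaLabel :=
  {t | ∃ i < m, t = ⟨3 * i + 3, 3 * i + 2, 3 * i + 1⟩}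

theorem separated_consecutiveLabels (m : ℕ) : Separated (consecutiveLabels m) := by
  refine ⟨?_, ?_⟩
  · rintro _ ⟨i, -, rfl⟩
    exact ⟨by simp, by simp⟩
  · rintro _ ⟨i, -, rfl⟩ _ ⟨j, -, rfl⟩ h
    have hij : i ≠ j := fun hij => h (by rw [hij])
    rw [Set.disjoint_left]
    rintro n ⟨h1, h2⟩ ⟨h3, h4⟩
    simp only at h1 h2 h3 h4
    omega

theorem ncard_consecutiveLabels (m : ℕ) : (consecutiveLabels m).ncard = m := by
  have : consecutiveLabels m =
      (fun i => (⟨3 * i + 3, 3 * i + 2, 3 * i + 1⟩ : KostkaLabel)) '' Set.Iio m := by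
    ext t
    constructor
    · rintro ⟨i, hi, rfl⟩
      exact ⟨i, hi, rfl⟩
    · rintro ⟨i, hi, rfl⟩
      exact ⟨i, hi, rfl⟩
  rw [this, Set.InjOn.ncard_image, ← Finset.coe_Iio, Set.ncard_coe_finset, Nat.card_Iio]
  intro i _ j _ h
  simp only [KostkaLabel.mk.injEq] at h
  omega

theorem indices_consecutiveLabels (m : ℕ) :
    indices (supportUnion (consecutiveLabels m)) = Set.Icc 1 (3 * m) := by
  ext n
  constructor
  · rintro (h | h)
    · obtain ⟨_, ⟨i, hi, rfl⟩, h1⟩ := mem_supportUnion.1 h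
      simp only [lam_mem_labelSupport] at h1
      exact ⟨by omega, by omega⟩
    · obtain ⟨_, ⟨i, hi, rfl⟩, h1⟩ := mem_supportUnion.1 h
      simp only [mu_mem_labelSupport] at h1
      exact ⟨by omega, by omega⟩
  · rintro ⟨h1, h2⟩
    obtain ⟨i, hi, hn⟩ : ∃ i < m, n = 3 * i + 3 ∨ n = 3 * i + 2 ∨ n = 3 * i + 1 :=
      ⟨(n - 1) / 3, by omega, by omega⟩
    by_cases hb : n = 3 * i + 2
    · exact Or.inl (mem_supportUnion.2 ⟨_, ⟨i, hi, rfl⟩, hb⟩)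
    · refine Or.inr (mem_supportUnion.2 ⟨_, ⟨i, hi, rfl⟩, ?_⟩)
      simp only [mu_mem_labelSupport]
      omega

/-- Each integer of `[ℓ, a]` is an entry of some label, which by disjointness is the label itself;
so the interval has three elements. Disjoint blocks of three filling `{1, …, 3m}` are determined
from the left. -/
theorem Separated.eq_consecutiveLabels {T : Set KostkaLabel} (hT : Separated T) {m : ℕ}
    (hval : ∀ n, (∃ t ∈ T, n = t.a ∨ n = t.b ∨ n = t.ℓ) ↔ n ∈ Set.Icc 1 (3 * m)) :
    T = consecutiveLabels m := by
  have hshape : ∀ t ∈ T, 1 ≤ t.ℓ ∧ t.b = t.ℓ + 1 ∧ t.a = t.ℓ + 2 ∧ t.a ≤ 3 * m := fun t ht => by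
    obtain ⟨h1, h2⟩ := hT.1 t ht
    have hl := (hval t.ℓ).1 ⟨t, ht, by tauto⟩
    have ha := (hval t.a).1 ⟨t, ht, by tauto⟩
    have hin : ∀ n, t.ℓ ≤ n → n ≤ t.a → n = t.a ∨ n = t.b ∨ n = t.ℓ := fun n h3 h4 => by
      obtain ⟨s, hs, hn⟩ := (hval n).2 ⟨hl.1.trans h3, h4.trans ha.2⟩
      obtain ⟨h5, h6⟩ := hT.1 s hs
      rwa [hT.eq_of_mem ht hs h3 h4 (by omega) (by omega)]
    have h3 := hin (t.ℓ + 1) (by omega) (by omega)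
    have h4 := hin (t.b + 1) (by omega) (by omega)
    exact ⟨hl.1, by omega, by omega, ha.2⟩
  have hmem : ∀ i < m, (⟨3 * i + 3, 3 * i + 2, 3 * i + 1⟩ : KostkaLabel) ∈ T := by
    intro i
    induction i with
    | zero =>
      intro hi
      obtain ⟨t, ht, hn⟩ := (hval 1).2 ⟨le_rfl, by omega⟩
      obtain ⟨h1, h2, h3, -⟩ := hshape t ht
      have : t = ⟨3 * 0 + 3, 3 * 0 + 2, 3 * 0 + 1⟩ :=
        KostkaLabel.ext (by simp only; omega) (by simp only; omega) (by simp only; omega)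
      exact this ▸ ht
    | succ i ih =>
      intro hi
      have hprev := ih (by omega)
      obtain ⟨t, ht, hn⟩ := (hval (3 * (i + 1) + 1)).2 ⟨by omega, by omega⟩
      obtain ⟨h1, h2, h3, -⟩ := hshape t ht
      have hl : t.ℓ = 3 * (i + 1) + 1 := by
        by_contra hne
        have := hT.eq_of_mem (n := 3 * i + 3) ht hprev (by omega) (by omega)
          (by simp only; omega) (by simp only; omega)
        subst this
        simp only at hn
        omega
      have : t = ⟨3 * (i + 1) + 3, 3 * (i + 1) + 2, 3 * (i + 1) + 1⟩ :=
        KostkaLabel.ext (by simp only; omega) (by simp only; omega) (by simp only; omega)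
      exact this ▸ ht
  apply Set.Subset.antisymm
  · intro t ht
    obtain ⟨h1, h2, h3, h4⟩ := hshape t ht
    have hi : (t.ℓ - 1) / 3 < m := by omega
    have hs := hmem _ hi
    have := hT.eq_of_mem (n := t.ℓ) ht hs le_rfl (by omega) (by simp only; omega)
      (by simp only; omega)
    exact ⟨_, hi, this⟩
  · rintro _ ⟨i, hi, rfl⟩
    exact hmem i hi

/-- With `3d+3` indices, the entry bound is attained and `0` cannot be an extra entry. Thus the
labels are separated with entries exactly `{1, …, 3d+3}`. -/
theorem facialCount_top (d : ℕ) : facialCount d (3 * d + 3) = 1 := by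
  have hk : 3 * d + 3 = 3 * (d + 1) := by ring
  have hsep := separated_consecutiveLabels (d + 1)
  have : facialWith d (Set.Icc 1 (3 * d + 3)) = {supportUnion (consecutiveLabels (d + 1))} := by
    apply Set.Subset.antisymm
    · rintro A ⟨hA, hw, hI⟩
      have hf : (indices A).Finite := hI ▸ Set.finite_Icc 1 _
      have h1 := hA.ncard_labelValues_le hf
      have hle : (labelValues A).ncard ≤ (indices A).ncard := by
        rw [hI, ← Finset.coe_Icc, Set.ncard_coe_finset, Nat.card_Icc]
        omega
      have heq : indices A = labelValues A :=
        Set.eq_of_subset_of_ncard_le hA.indices_subset_labelValues hle (finite_labelValues hf)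
      have h2 : 3 * weight A ≤ (labelValues A).ncard := by
        rw [← heq, hI, ← Finset.coe_Icc, Set.ncard_coe_finset, Nat.card_Icc]
        omega
      obtain ⟨hs, -⟩ := hA.separated_labels hf h2
      have hl : labels A = consecutiveLabels (d + 1) := hs.eq_consecutiveLabels fun n => by
        rw [← hk, ← hI, heq]
        rfl
      rw [Set.mem_singleton_iff, ← hl, hA.supportUnion_labels]
    · rintro _ rfl
      refine ⟨facial_supportUnion fun t ht => Or.inl (hsep.1 t ht), ?_, ?_⟩
      · rw [hsep.weight_supportUnion, ncard_consecutiveLabels]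
      · rw [indices_consecutiveLabels, hk]
  rw [facialCount, this, Set.ncard_singleton]

/-! ### The facet forms and the cone they define -/

/-- The `n`-th entry of a tuple, extended by zero. -/
def part {r : ℕ} (n : ℕ) : (Fin r → ℝ) →ₗ[ℝ] ℝ :=
  if h : n < r then LinearMap.proj ⟨n, h⟩ else 0

/-- The linear form of a facet inequality. -/
def facetForm (r : ℕ) : Facet → KostkaSpace r →ₗ[ℝ] ℝ
  | .lam 0 => 0
  | .lam (n + 1) => (part n - part (n + 1)) ∘ₗ LinearMap.fst ℝ _ _
  | .mu 0 => 0
  | .mu (n + 1) => (part n - part (n + 1)) ∘ₗ LinearMap.snd ℝ _ _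
  | .dom n => ∑ j ∈ Finset.range n,
      (part j ∘ₗ LinearMap.fst ℝ _ _ - part j ∘ₗ LinearMap.snd ℝ _ _)

/-- The sum of all coordinates. -/
def size (r : ℕ) : KostkaSpace r →ₗ[ℝ] ℝ :=
  ∑ i, (LinearMap.proj i ∘ₗ LinearMap.fst ℝ _ _ + LinearMap.proj i ∘ₗ LinearMap.snd ℝ _ _)

/-- The cone cut out by the facet inequalities. -/
def cone (r : ℕ) : Set (KostkaSpace r) :=
  {p | (∀ f, 0 ≤ facetForm r f p) ∧ facetForm r (.dom r) p = 0}

/-- The inequalities that are strict at `p`. -/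
def strictAt {r : ℕ} (p : KostkaSpace r) : Set Facet := {f | 0 < facetForm r f p}

section forms

variable {r : ℕ}

theorem part_of_lt {n : ℕ} (h : n < r) (g : Fin r → ℝ) : part n g = g ⟨n, h⟩ := by
  simp [part, h]

theorem part_of_le {n : ℕ} (h : r ≤ n) (g : Fin r → ℝ) : part n g = 0 := by
  simp [part, Nat.not_lt.2 h]

theorem part_val (i : Fin r) (g : Fin r → ℝ) : part (i : ℕ) g = g i := part_of_lt i.2 g

@[simp] theorem facetForm_lam_zero (p : KostkaSpace r) : facetForm r (.lam 0) p = 0 := rfl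

@[simp] theorem facetForm_mu_zero (p : KostkaSpace r) : facetForm r (.mu 0) p = 0 := rfl

theorem facetForm_lam_succ (n : ℕ) (p : KostkaSpace r) :
    facetForm r (.lam (n + 1)) p = part n p.1 - part (n + 1) p.1 := rfl

theorem facetForm_mu_succ (n : ℕ) (p : KostkaSpace r) :
    facetForm r (.mu (n + 1)) p = part n p.2 - part (n + 1) p.2 := rfl

theorem facetForm_dom (n : ℕ) (p : KostkaSpace r) :
    facetForm r (.dom n) p = ∑ j ∈ Finset.range n, (part j p.1 - part j p.2) := by
  simp [facetForm]

@[simp] theorem facetForm_dom_zero (p : KostkaSpace r) : facetForm r (.dom 0) p = 0 := by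
  simp [facetForm_dom]

theorem facetForm_dom_succ (n : ℕ) (p : KostkaSpace r) :
    facetForm r (.dom (n + 1)) p =
      facetForm r (.dom n) p + (part n p.1 - part n p.2) := by
  rw [facetForm_dom, facetForm_dom, Finset.sum_range_succ]

/-- The relation that links the three families: where `D` is strictly concave `λ` must descend, and
where it is strictly convex `μ` must. -/
theorem facetForm_dom_second_difference (n : ℕ) (p : KostkaSpace r) :
    facetForm r (.dom (n + 2)) p - 2 * facetForm r (.dom (n + 1)) p + facetForm r (.dom n) p =
      facetForm r (.mu (n + 1)) p - facetForm r (.lam (n + 1)) p := by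
  rw [facetForm_dom_succ (n + 1), facetForm_dom_succ n, facetForm_mu_succ, facetForm_lam_succ]
  ring

theorem facetForm_lam_of_lt {n : ℕ} (h : r < n) (p : KostkaSpace r) :
    facetForm r (.lam n) p = 0 := by
  obtain ⟨m, rfl⟩ := Nat.exists_eq_succ_of_ne_zero (by omega : n ≠ 0)
  rw [facetForm_lam_succ, part_of_le (by omega), part_of_le (by omega), sub_zero]

theorem facetForm_mu_of_lt {n : ℕ} (h : r < n) (p : KostkaSpace r) :
    facetForm r (.mu n) p = 0 := by
  obtain ⟨m, rfl⟩ := Nat.exists_eq_succ_of_ne_zero (by omega : n ≠ 0)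
  rw [facetForm_mu_succ, part_of_le (by omega), part_of_le (by omega), sub_zero]

theorem facetForm_dom_of_le {n : ℕ} (h : r ≤ n) (p : KostkaSpace r) :
    facetForm r (.dom n) p = facetForm r (.dom r) p := by
  induction n, h using Nat.le_induction with
  | base => rfl
  | succ n hn ih => rw [facetForm_dom_succ, ih, part_of_le hn, part_of_le hn]; ring

theorem part_eq_zero_of_descents {g : Fin r → ℝ}
    (h : ∀ n : ℕ, part n g - part (n + 1) g = 0) (n : ℕ) : part n g = 0 := by
  have key : ∀ k, part n g = part (n + k) g := fun k => by
    induction k with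
    | zero => rfl
    | succ k ih => rw [ih]; exact sub_eq_zero.1 (h (n + k))
  rw [key r, part_of_le (by omega)]

theorem eq_zero_of_parts {g : Fin r → ℝ} (h : ∀ n : ℕ, part n g = 0) : g = 0 :=
  funext fun i => by rw [← part_val i g, h]; rfl

theorem eq_zero_of_facetForm {p : KostkaSpace r} (hl : ∀ n, facetForm r (.lam n) p = 0)
    (hm : ∀ n, facetForm r (.mu n) p = 0) : p = 0 :=
  Prod.ext (eq_zero_of_parts (part_eq_zero_of_descents fun n => hl (n + 1)))
    (eq_zero_of_parts (part_eq_zero_of_descents fun n => hm (n + 1)))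

theorem part_nonneg_of_descents {g : Fin r → ℝ}
    (h : ∀ n : ℕ, 0 ≤ part n g - part (n + 1) g) (n : ℕ) : 0 ≤ part n g := by
  have key : ∀ k, part (n + k) g ≤ part n g := fun k => by
    induction k with
    | zero => exact le_rfl
    | succ k ih => exact (sub_nonneg.1 (h (n + k))).trans ih
  have := key r
  rwa [part_of_le (by omega)] at this

theorem size_apply (p : KostkaSpace r) : size r p = ∑ i, (p.1 i + p.2 i) := by
  simp [size]

theorem fst_nonneg_of_mem_cone {p : KostkaSpace r} (hp : p ∈ cone r) (i : Fin r) : 0 ≤ p.1 i := by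
  rw [← part_val i p.1]
  exact part_nonneg_of_descents (fun n => hp.1 (.lam (n + 1))) i

theorem snd_nonneg_of_mem_cone {p : KostkaSpace r} (hp : p ∈ cone r) (i : Fin r) : 0 ≤ p.2 i := by
  rw [← part_val i p.2]
  exact part_nonneg_of_descents (fun n => hp.1 (.mu (n + 1))) i

theorem size_nonneg {p : KostkaSpace r} (hp : p ∈ cone r) : 0 ≤ size r p := by
  rw [size_apply]
  exact Finset.sum_nonneg fun i _ =>
    add_nonneg (fst_nonneg_of_mem_cone hp i) (snd_nonneg_of_mem_cone hp i)

theorem eq_zero_of_size_eq_zero {p : KostkaSpace r} (hp : p ∈ cone r) (h : size r p = 0) :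
    p = 0 := by
  rw [size_apply, Finset.sum_eq_zero_iff_of_nonneg fun i _ =>
    add_nonneg (fst_nonneg_of_mem_cone hp i) (snd_nonneg_of_mem_cone hp i)] at h
  refine Prod.ext (funext fun i => ?_) (funext fun i => ?_)
  · have h1 := h i (Finset.mem_univ i)
    have h2 := fst_nonneg_of_mem_cone hp i
    have h3 := snd_nonneg_of_mem_cone hp i
    simp only [Prod.fst_zero, Pi.zero_apply]
    linarith
  · have h1 := h i (Finset.mem_univ i)
    have h2 := fst_nonneg_of_mem_cone hp i
    have h3 := snd_nonneg_of_mem_cone hp i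
    simp only [Prod.snd_zero, Pi.zero_apply]
    linarith

theorem size_pos {p : KostkaSpace r} (hp : p ∈ cone r) (h0 : p ≠ 0) : 0 < size r p :=
  lt_of_le_of_ne (size_nonneg hp) fun h => h0 (eq_zero_of_size_eq_zero hp h.symm)

theorem add_mem_cone {p q : KostkaSpace r} (hp : p ∈ cone r) (hq : q ∈ cone r) :
    p + q ∈ cone r :=
  ⟨fun f => by rw [map_add]; exact add_nonneg (hp.1 f) (hq.1 f), by
    rw [map_add, hp.2, hq.2, add_zero]⟩

theorem smul_mem_cone {p : KostkaSpace r} (hp : p ∈ cone r) {c : ℝ} (hc : 0 ≤ c) :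
    c • p ∈ cone r :=
  ⟨fun f => by rw [map_smul]; exact mul_nonneg hc (hp.1 f), by
    rw [map_smul, hp.2, smul_zero]⟩

theorem zero_mem_cone : (0 : KostkaSpace r) ∈ cone r :=
  ⟨fun f => by rw [map_zero], map_zero _⟩

theorem convex_cone : Convex ℝ (cone r) := fun _ hp _ hq _ _ ha hb _ =>
  add_mem_cone (smul_mem_cone hp ha) (smul_mem_cone hq hb)

theorem facetForm_eq_zero_iff {p : KostkaSpace r} (hp : p ∈ cone r) {f : Facet} :
    facetForm r f p = 0 ↔ f ∉ strictAt p := by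
  constructor
  · intro h h'
    have h2 : 0 < facetForm r f p := h'
    exact h2.ne' h
  · intro h
    exact le_antisymm (not_lt.1 h) (hp.1 f)

theorem indices_strictAt_subset (p : KostkaSpace r) : indices (strictAt p) ⊆ Set.Icc 1 r := by
  rintro n (h | h)
  · constructor
    · rw [Nat.one_le_iff_ne_zero]
      rintro rfl
      exact lt_irrefl (0 : ℝ) h
    · by_contra hn
      have h2 : 0 < facetForm r (.lam n) p := h
      exact h2.ne' (facetForm_lam_of_lt (not_le.1 hn) p)
  · constructor
    · rw [Nat.one_le_iff_ne_zero]
      rintro rfl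
      exact lt_irrefl (0 : ℝ) h
    · by_contra hn
      have h2 : 0 < facetForm r (.mu n) p := h
      exact h2.ne' (facetForm_mu_of_lt (not_le.1 hn) p)

theorem strictAt_subset_facetsUpTo {p : KostkaSpace r} (hp : p ∈ cone r) :
    strictAt p ⊆ facetsUpTo r := by
  rintro (n | n | n) h
  · exact Or.inl (Or.inl ⟨n, (indices_strictAt_subset p (Or.inl h)).2, rfl⟩)
  · exact Or.inl (Or.inr ⟨n, (indices_strictAt_subset p (Or.inr h)).2, rfl⟩)
  · refine Or.inr ⟨n, ?_, rfl⟩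
    rw [Set.mem_Iic]
    by_contra hn
    have h' : 0 < facetForm r (.dom n) p := h
    rw [facetForm_dom_of_le (not_le.1 hn).le, hp.2] at h'
    exact lt_irrefl _ h'

theorem finite_strictAt {p : KostkaSpace r} (hp : p ∈ cone r) : (strictAt p).Finite :=
  (finite_facetsUpTo r).subset (strictAt_subset_facetsUpTo hp)

end forms

/-! ### Generators of the cone -/

/-- A sequence that starts and eventually stays at zero and is positive somewhere has a strict
peak. -/
theorem exists_peak {D : ℕ → ℝ} {r : ℕ} (h0 : D 0 = 0) (hr : ∀ n, r ≤ n → D n = 0) {k : ℕ}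
    (hk : 0 < D k) : ∃ n, 0 < D (n + 1) ∧ D (n + 2) - 2 * D (n + 1) + D n < 0 := by
  classical
  have hex : ∃ b, ∀ m, D m ≤ D b := by
    obtain ⟨b, -, hb⟩ := Finset.exists_max_image (Finset.range (r + 1)) D ⟨0, by simp⟩
    refine ⟨b, fun m => ?_⟩
    rcases le_or_gt r m with h | h
    · rw [hr m h, ← h0]
      exact hb 0 (by simp)
    · exact hb m (by simp; omega)
  -- `Nat.find` takes the first maximizer, which makes the increase on its left strict; it is not
  -- `0` because `D 0 = 0 < D k`.
  obtain ⟨n, hn⟩ : ∃ n, Nat.find hex = n + 1 := by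
    apply Nat.exists_eq_succ_of_ne_zero
    intro h
    have := Nat.find_spec hex k
    rw [h, h0] at this
    linarith
  have hmax := Nat.find_spec hex
  rw [hn] at hmax
  have hlt : D n < D (n + 1) := by
    have hnot := Nat.find_min hex (m := n) (by omega)
    push Not at hnot
    obtain ⟨m, hm⟩ := hnot
    exact hm.trans_le (hmax m)
  exact ⟨n, hk.trans_le (hmax k), by linarith [hmax (n + 2)]⟩

section generators

variable {r : ℕ}

theorem part_fst_rayGenerator {a b l : ℕ} (hb : b ≤ r) (n : ℕ) :
    part n (rayGenerator r a b l).1 = if n < b then (a : ℝ) - l else 0 := by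
  by_cases h : n < r
  · rw [part_of_lt h]; rfl
  · rw [part_of_le (by omega), if_neg (by omega)]

theorem part_snd_rayGenerator {a b l : ℕ} (ha : a ≤ r) (hl : l ≤ a) (n : ℕ) :
    part n (rayGenerator r a b l).2 =
      if n < l then (a : ℝ) - l else if n < a then (b : ℝ) - l else 0 := by
  by_cases h : n < r
  · rw [part_of_lt h]; rfl
  · rw [part_of_le (by omega), if_neg (by omega), if_neg (by omega)]

theorem facetForm_lam_rayGenerator {a b l : ℕ} (hb : b ≤ r) (n : ℕ) (h0 : 0 < b) :
    facetForm r (.lam n) (rayGenerator r a b l) = if n = b then (a : ℝ) - l else 0 := by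
  rcases n with - | n
  · rw [facetForm_lam_zero, if_neg h0.ne]
  · rw [facetForm_lam_succ, part_fst_rayGenerator hb, part_fst_rayGenerator hb]
    split_ifs <;> first | omega | ring

theorem facetForm_mu_rayGenerator {a b l : ℕ} (ha : a ≤ r) (hla : l < a) (n : ℕ) :
    facetForm r (.mu n) (rayGenerator r a b l) =
      if n = 0 then 0 else if n = a then (b : ℝ) - l else if n = l then (a : ℝ) - b else 0 := by
  rcases n with - | n
  · rw [facetForm_mu_zero, if_pos rfl]
  · rw [facetForm_mu_succ, part_snd_rayGenerator ha hla.le, part_snd_rayGenerator ha hla.le]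
    rw [if_neg (Nat.succ_ne_zero n)]
    split_ifs <;> first | omega | ring

/-- For `ℓ < b < a` the profile of `D` is a tent over `[ℓ, a]` with its top at `b`; in the
degenerate case it is identically zero. -/
theorem facetForm_dom_rayGenerator {a b l : ℕ} (ha : a ≤ r) (hlb : l ≤ b) (hba : b ≤ a)
    (n : ℕ) :
    facetForm r (.dom n) (rayGenerator r a b l) =
      if n ≤ l then 0 else if n ≤ b then ((a : ℝ) - b) * (n - l)
        else if n ≤ a then ((b : ℝ) - l) * (a - n) else 0 := by
  induction n with
  | zero => simp
  | succ n ih =>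
    rw [facetForm_dom_succ, ih, part_fst_rayGenerator (hba.trans ha),
      part_snd_rayGenerator ha (hlb.trans hba)]
    push_cast
    rcases lt_trichotomy n l with h | h | h
    · rw [if_pos h.le, if_pos (by omega), if_pos h, if_pos (by omega)]; ring
    · subst h
      rcases eq_or_lt_of_le hlb with rfl | h2
      · rcases eq_or_lt_of_le hba with rfl | h3
        · simp
        · simp [h3]
      · rw [if_pos le_rfl, if_pos h2, if_neg (lt_irrefl _), if_pos (by omega),
          if_neg (by omega), if_pos (by omega)]
        ring
    · rw [if_neg (by omega), if_neg (by omega : ¬ n < l), if_neg (by omega : ¬ n + 1 ≤ l)]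
      rcases lt_trichotomy n b with h2 | h2 | h2
      · rw [if_pos h2.le, if_pos h2, if_pos (by omega), if_pos (by omega)]; ring
      · subst h2
        rw [if_pos le_rfl, if_neg (lt_irrefl _), if_neg (by omega : ¬ n + 1 ≤ n)]
        rcases eq_or_lt_of_le hba with rfl | h3
        · simp
        · rw [if_pos h3, if_pos (by omega)]; ring
      · rw [if_neg (by omega : ¬ n ≤ b), if_neg (by omega : ¬ n < b),
          if_neg (by omega : ¬ n + 1 ≤ b)]
        rcases lt_trichotomy n a with h3 | h3 | h3
        · rw [if_pos h3.le, if_pos h3, if_pos (by omega)]; ring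
        · subst h3
          simp
        · rw [if_neg (by omega : ¬ n ≤ a), if_neg (by omega : ¬ n < a),
            if_neg (by omega : ¬ n + 1 ≤ a)]
          ring

/-- A generator of the ray labeled by `t`. -/
def gen (r : ℕ) (t : KostkaLabel) : KostkaSpace r :=
  -- A degenerate label has `ℓ = b = a`, where the generator formula would give the zero vector. Any
  -- smaller `ℓ` spans the right ray, and `0` is chosen.
  rayGenerator r t.a t.b (if t.ℓ < t.b then t.ℓ else 0)

theorem facetForm_gen_pos {t : KostkaLabel} (ht : Valid t) (ha : t.a ≤ r) {f : Facet}
    (hf : f ∈ labelSupport t) : 0 < facetForm r f (gen r t) := by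
  unfold gen
  have hb0 := ht.pos_b
  rcases ht with ⟨h1, h2⟩ | hd
  · rw [if_pos h1]
    have h1' : (t.ℓ : ℝ) < t.b := by exact_mod_cast h1
    have h2' : (t.b : ℝ) < t.a := by exact_mod_cast h2
    rcases f with n | n | n
    · rw [lam_mem_labelSupport] at hf
      rw [facetForm_lam_rayGenerator (by omega) _ hb0, if_pos hf]
      linarith
    · obtain ⟨hn, hf⟩ := hf
      rw [facetForm_mu_rayGenerator ha (by omega), if_neg hn.ne']
      split_ifs
      · linarith
      · linarith
      · omega
    · obtain ⟨h3, h4⟩ := hf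
      rw [facetForm_dom_rayGenerator ha h1.le h2.le, if_neg (by omega)]
      have h3' : (t.ℓ : ℝ) < n := by exact_mod_cast h3
      have h4' : (n : ℝ) < t.a := by exact_mod_cast h4
      split_ifs
      · exact mul_pos (by linarith) (by linarith)
      · exact mul_pos (by linarith) (by linarith)
      · omega
  · rw [if_neg (by omega)]
    have h3 : (0 : ℝ) < t.a := by exact_mod_cast hd.2.2
    have h4 : (0 : ℝ) < t.b := by exact_mod_cast hb0
    rcases f with n | n | n
    · rw [lam_mem_labelSupport] at hf
      rw [facetForm_lam_rayGenerator (by omega) _ hb0, if_pos hf]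
      simpa using h3
    · obtain ⟨hn, hf⟩ := hf
      rw [facetForm_mu_rayGenerator ha (by omega), if_neg hn.ne', if_pos (by omega)]
      simpa using h4
    · obtain ⟨h3, h4⟩ := hf
      omega

theorem facetForm_gen_eq_zero {t : KostkaLabel} (ht : Valid t) (ha : t.a ≤ r) {f : Facet}
    (hf : f ∉ labelSupport t) : facetForm r f (gen r t) = 0 := by
  unfold gen
  have hb0 := ht.pos_b
  rcases ht with ⟨h1, h2⟩ | hd
  · rw [if_pos h1]
    rcases f with n | n | n
    · rw [lam_mem_labelSupport] at hf
      rw [facetForm_lam_rayGenerator (by omega) _ hb0, if_neg hf]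
    · rw [mu_mem_labelSupport] at hf
      rw [facetForm_mu_rayGenerator ha (by omega)]
      split_ifs <;> first | rfl | omega
    · rw [dom_mem_labelSupport] at hf
      rw [facetForm_dom_rayGenerator ha h1.le h2.le]
      split_ifs with h3 h4 h5
      · rfl
      · omega
      · have : n = t.a := by omega
        rw [this]
        ring
      · rfl
  · rw [if_neg (by omega)]
    rcases f with n | n | n
    · rw [lam_mem_labelSupport] at hf
      rw [facetForm_lam_rayGenerator (by omega) _ hb0, if_neg hf]
    · rw [mu_mem_labelSupport] at hf
      rw [facetForm_mu_rayGenerator ha (by omega)]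
      split_ifs <;> first | rfl | omega
    · rw [facetForm_dom_rayGenerator ha (by omega) (by omega), hd.1]
      split_ifs <;> simp

theorem gen_mem_cone {t : KostkaLabel} (ht : Valid t) (ha : t.a ≤ r) : gen r t ∈ cone r := by
  refine ⟨fun f => ?_, facetForm_gen_eq_zero ht ha fun h => ?_⟩
  · by_cases hf : f ∈ labelSupport t
    · exact (facetForm_gen_pos ht ha hf).le
    · exact (facetForm_gen_eq_zero ht ha hf).ge
  · have := h.2
    omega

theorem strictAt_gen {t : KostkaLabel} (ht : Valid t) (ha : t.a ≤ r) :
    strictAt (gen r t) = labelSupport t := by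
  ext f
  refine ⟨fun h => ?_, facetForm_gen_pos ht ha⟩
  by_contra hf
  exact (facetForm_eq_zero_iff (gen_mem_cone ht ha)).1 (facetForm_gen_eq_zero ht ha hf) h

/-- A nonzero point of the cone has all the strict inequalities of some ray. -/
theorem exists_label_of_ne_zero {p : KostkaSpace r} (hp : p ∈ cone r) (h0 : p ≠ 0) :
    ∃ t, t ∈ labels (strictAt p) := by
  classical
  set D : ℕ → ℝ := fun n => facetForm r (.dom n) p with hD
  have hD0 : D 0 = 0 := facetForm_dom_zero p
  have hDr : ∀ n, r ≤ n → D n = 0 := fun n hn => (facetForm_dom_of_le hn p).trans hp.2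
  have hDnn : ∀ n, 0 ≤ D n := fun n => hp.1 _
  have h2 : ∀ n, D (n + 2) - 2 * D (n + 1) + D n =
      facetForm r (.mu (n + 1)) p - facetForm r (.lam (n + 1)) p := fun n =>
    facetForm_dom_second_difference n p
  by_cases hpos : ∃ k, 0 < D k
  · obtain ⟨k, hk⟩ := hpos
    obtain ⟨m, hm1, hm2⟩ := exists_peak hD0 hDr hk
    have hlam : Facet.lam (m + 1) ∈ strictAt p := by
      have h3 : 0 ≤ facetForm r (.mu (m + 1)) p := hp.1 _
      have h4 := h2 m
      change 0 < facetForm r (.lam (m + 1)) p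
      linarith
    -- The label has the peak as `b`, and as `a` and `ℓ` the nearest zeros of `D` on its two sides.
    have hex : ∃ n, m + 1 < n ∧ D n = 0 := ⟨max r (m + 2), by omega, hDr _ (le_max_left _ _)⟩
    obtain ⟨ha1, ha2⟩ := Nat.find_spec hex
    have ha3 : ∀ n, m + 1 < n → n < Nat.find hex → 0 < D n := fun n h5 h6 =>
      lt_of_le_of_ne (hDnn n) fun h => Nat.find_min hex h6 ⟨h5, h.symm⟩
    set a := Nat.find hex with ha
    set l := Nat.findGreatest (fun n => D n = 0) m with hl
    have hl1 : D l = 0 := Nat.findGreatest_spec (P := fun n => D n = 0) (Nat.zero_le m) hD0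
    have hl2 : l ≤ m := Nat.findGreatest_le m
    have hl3 : ∀ n, l < n → n ≤ m → 0 < D n := fun n h5 h6 =>
      lt_of_le_of_ne (hDnn n) fun h => by
        have := Nat.le_findGreatest (P := fun n => D n = 0) h6 h.symm
        omega
    have hin : ∀ n, l < n → n < a → 0 < D n := fun n h5 h6 => by
      rcases lt_trichotomy n (m + 1) with h7 | h7 | h7
      · exact hl3 n h5 (by omega)
      · rwa [h7]
      · exact ha3 n h7 h6
    have hmu : ∀ n, D (n + 1) = 0 → 0 < D n ∨ 0 < D (n + 2) → Facet.mu (n + 1) ∈ strictAt p := by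
      intro n h5 h6
      have h7 : 0 ≤ facetForm r (.lam (n + 1)) p := hp.1 _
      have h8 := h2 n
      have h9 := hDnn n
      have h10 := hDnn (n + 2)
      change 0 < facetForm r (.mu (n + 1)) p
      rcases h6 with h6 | h6 <;> linarith
    refine ⟨⟨a, m + 1, l⟩, Or.inl ⟨by simp only; omega, ha1⟩, ?_⟩
    rintro (n | n | n) hn
    · rw [lam_mem_labelSupport] at hn
      exact hn ▸ hlam
    · obtain ⟨hn0, hn⟩ := hn
      obtain ⟨n, rfl⟩ := Nat.exists_eq_succ_of_ne_zero hn0.ne'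
      rcases hn with hn | hn
      · simp only at hn
        exact hmu n (by rw [← Nat.succ_eq_add_one, hn]; exact ha2)
          (Or.inl (hin n (by omega) (by omega)))
      · simp only at hn
        exact hmu n (by rw [← Nat.succ_eq_add_one, hn]; exact hl1)
          (Or.inr (hin (n + 2) (by omega) (by omega)))
    · exact hin n hn.1 hn.2
  -- If `D` vanishes, the two tuples have equal descents, and any descent index `n` gives the label
  -- `(n, n, n)`.
  · have hDz : ∀ n, D n = 0 := fun n => le_antisymm (not_lt.1 fun h => hpos ⟨n, h⟩) (hDnn n)
    have heq : ∀ n, facetForm r (.mu n) p = facetForm r (.lam n) p := fun n => by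
      rcases n with - | n
      · simp
      · have h3 := h2 n
        rw [hDz, hDz, hDz] at h3
        linarith
    obtain ⟨n, hn⟩ : ∃ n, 0 < facetForm r (.lam n) p := by
      by_contra hno
      have hz : ∀ n, facetForm r (.lam n) p = 0 := fun n =>
        le_antisymm (not_lt.1 fun h => hno ⟨n, h⟩) (hp.1 _)
      exact h0 (eq_zero_of_facetForm hz fun n => (heq n).trans (hz n))
    have hn0 : 0 < n := by
      rcases n with - | n
      · exact absurd hn (lt_irrefl _)
      · omega
    refine ⟨⟨n, n, n⟩, Or.inr ⟨rfl, rfl, hn0⟩, ?_⟩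
    rintro (m | m | m) hm
    · rw [lam_mem_labelSupport] at hm
      subst hm
      exact hn
    · rw [mu_mem_labelSupport] at hm
      have : m = n := by simp only at hm; omega
      subst this
      exact hn.trans_eq (heq m).symm
    · rw [dom_mem_labelSupport] at hm
      simp only at hm
      omega

theorem a_le_of_mem_labels_strictAt {p : KostkaSpace r} {t : KostkaLabel}
    (ht : t ∈ labels (strictAt p)) : t.a ≤ r :=
  (indices_strictAt_subset p (a_mem_indices ht)).2

open scoped NNReal in
/-- A point of the cone is a nonnegative combination of the generators whose strict inequalities
are strict at the point. -/
theorem mem_span_gen {p : KostkaSpace r} (hp : p ∈ cone r) :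
    p ∈ Submodule.span ℝ≥0 (gen r '' labels (strictAt p)) := by
  induction hn : (strictAt p).ncard using Nat.strong_induction_on generalizing p with
  | _ n ih =>
  by_cases h0 : p = 0
  · rw [h0]
    exact Submodule.zero_mem _
  obtain ⟨t, ht⟩ := exists_label_of_ne_zero hp h0
  have ha := a_le_of_mem_labels_strictAt ht
  have hfin : (labelSupport t).Finite := (finite_strictAt hp).subset ht.2
  -- The least ratio is the largest multiple of the generator that can be subtracted inside the
  -- cone. It makes `f₀` tight, so the number of strict inequalities drops.
  obtain ⟨f₀, hf₀, hmin⟩ := Set.exists_min_image (labelSupport t)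
    (fun f => facetForm r f p / facetForm r f (gen r t)) hfin ⟨.lam t.b, rfl⟩
  set c : ℝ := facetForm r f₀ p / facetForm r f₀ (gen r t) with hc
  have hg0 := facetForm_gen_pos ht.1 ha hf₀
  have hcpos : 0 < c := div_pos (ht.2 hf₀) hg0
  set q := p - c • gen r t with hq
  have hval : ∀ f, facetForm r f q = facetForm r f p - c * facetForm r f (gen r t) := fun f => by
    rw [hq, map_sub, map_smul, smul_eq_mul]
  have hqc : q ∈ cone r := by
    refine ⟨fun f => ?_, ?_⟩
    · rw [hval]
      by_cases hf : f ∈ labelSupport t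
      · have := hmin f hf
        rw [le_div_iff₀ (facetForm_gen_pos ht.1 ha hf)] at this
        linarith
      · rw [facetForm_gen_eq_zero ht.1 ha hf, mul_zero, sub_zero]
        exact hp.1 f
    · rw [hval, hp.2, (gen_mem_cone ht.1 ha).2]
      ring
  have hsub : strictAt q ⊆ strictAt p := fun f hf => by
    have h1 : 0 < facetForm r f q := hf
    rw [hval] at h1
    have h2 := mul_nonneg hcpos.le ((gen_mem_cone ht.1 ha).1 f)
    change 0 < facetForm r f p
    linarith
  have hnot : f₀ ∉ strictAt q := fun hf => by
    have h1 : 0 < facetForm r f₀ q := hf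
    rw [hval, hc, div_mul_cancel₀ _ hg0.ne', sub_self] at h1
    exact lt_irrefl _ h1
  have hlt : (strictAt q).ncard < n := hn ▸ Set.ncard_lt_ncard
    ⟨hsub, fun h => hnot (h (ht.2 hf₀))⟩ (finite_strictAt hp)
  have hspan := ih _ hlt hqc rfl
  have hpq : p = q + c.toNNReal • gen r t := by
    rw [hq, NNReal.smul_def, Real.coe_toNNReal c hcpos.le, sub_add_cancel]
  have hsum := Submodule.add_mem _
    (Submodule.span_mono
      (Set.image_mono fun s hs => ⟨hs.1, hs.2.trans hsub⟩ :
        gen r '' labels (strictAt q) ⊆ gen r '' labels (strictAt p)) hspan)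
    (Submodule.smul_mem _ c.toNNReal (Submodule.subset_span ⟨t, ht, rfl⟩))
  rwa [← hpq] at hsum

/-- A form that vanished on every generator available at `p` would vanish at `p`, since these
generators span `p`. -/
theorem facial_strictAt {p : KostkaSpace r} (hp : p ∈ cone r) : Facial (strictAt p) := by
  intro f hf
  by_contra hno
  push Not at hno
  have : facetForm r f p = 0 := by
    refine Submodule.span_induction (p := fun q _ => facetForm r f q = 0) ?_ ?_ ?_ ?_
      (mem_span_gen hp)
    · rintro _ ⟨t, ht, rfl⟩
      exact facetForm_gen_eq_zero ht.1 (a_le_of_mem_labels_strictAt ht) (hno t ht)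
    · exact map_zero _
    · intro x y _ _ hx hy
      rw [map_add, hx, hy, add_zero]
    · intro c x _ hx
      rw [NNReal.smul_def, map_smul, hx, smul_zero]
  exact (facetForm_eq_zero_iff hp).1 this hf

end generators

/-! ### The convex hull of the integer points is the cone -/

section integer

variable {r : ℕ}

theorem sum_filter_lt (g : Fin r → ℝ) (k : ℕ) :
    ∑ i ∈ Finset.univ.filter (fun i : Fin r => (i : ℕ) < k), g i =
      ∑ j ∈ Finset.range k, part j g := by
  have h : ∀ j, part j g = ∑ i : Fin r, if (i : ℕ) = j then g i else 0 := fun j => by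
    by_cases hj : j < r
    · rw [part_of_lt hj, Finset.sum_eq_single ⟨j, hj⟩]
      · simp
      · intro i _ hi
        rw [if_neg fun h => hi (Fin.ext h)]
      · simp
    · rw [part_of_le (by omega), Finset.sum_eq_zero]
      intro i _
      rw [if_neg]
      have := i.2
      omega
  simp_rw [h]
  rw [Finset.sum_comm, Finset.sum_filter]
  refine Finset.sum_congr rfl fun i _ => ?_
  rw [Finset.sum_ite_eq]
  simp

theorem part_sub_part_nonneg {g : Fin r → ℕ} (hg : Antitone g) (n : ℕ) :
    0 ≤ part n (fun i => (g i : ℝ)) - part (n + 1) fun i => (g i : ℝ) := by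
  rcases lt_trichotomy (n + 1) r with h | h | h
  · rw [part_of_lt h, part_of_lt (by omega), sub_nonneg, Nat.cast_le]
    exact hg (by simp [Fin.le_def])
  · rw [part_of_le h.ge, part_of_lt (by omega), sub_zero]
    exact Nat.cast_nonneg _
  · rw [part_of_le (by omega), part_of_le (by omega), sub_zero]

theorem antitone_of_part {g : Fin r → ℕ}
    (h : ∀ n : ℕ, 0 ≤ part n (fun i => (g i : ℝ)) - part (n + 1) fun i => (g i : ℝ)) :
    Antitone g := by
  have hanti : Antitone fun n : ℕ => part n fun i => (g i : ℝ) :=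
    antitone_nat_of_succ_le fun n => sub_nonneg.1 (h n)
  intro i j hij
  have := hanti (Fin.le_def.1 hij)
  simp only [part_val, Nat.cast_le] at this
  exact this

theorem natCast_mem_cone_iff {x y : Fin r → ℕ} :
    ((fun i => (x i : ℝ), fun i => (y i : ℝ)) : KostkaSpace r) ∈ cone r ↔
      Antitone x ∧ Antitone y ∧ ∑ i, x i = ∑ i, y i ∧ Dominates x y := by
  have hdom : ∀ n, facetForm r (.dom n) ((fun i => (x i : ℝ), fun i => (y i : ℝ)) : KostkaSpace r) =
      ((∑ i ∈ Finset.univ.filter (fun i : Fin r => (i : ℕ) < n), x i : ℕ) : ℝ) -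
      ((∑ i ∈ Finset.univ.filter (fun i : Fin r => (i : ℕ) < n), y i : ℕ) : ℝ) := fun n => by
    rw [facetForm_dom, Finset.sum_sub_distrib, ← sum_filter_lt, ← sum_filter_lt]
    push_cast
    rfl
  have huniv : (Finset.univ.filter fun i : Fin r => (i : ℕ) < r) = Finset.univ :=
    Finset.filter_true_of_mem fun i _ => i.2
  constructor
  · rintro ⟨h1, h2⟩
    refine ⟨antitone_of_part fun n => h1 (.lam (n + 1)),
      antitone_of_part fun n => h1 (.mu (n + 1)), ?_, fun k _ => ?_⟩
    · rw [hdom, huniv, sub_eq_zero] at h2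
      exact_mod_cast h2
    · have := h1 (.dom k)
      rw [hdom, sub_nonneg] at this
      exact_mod_cast this
  · rintro ⟨hx, hy, hs, hd⟩
    have hr : facetForm r (.dom r)
        ((fun i => (x i : ℝ), fun i => (y i : ℝ)) : KostkaSpace r) = 0 := by
      rw [hdom, huniv, hs, sub_self]
    refine ⟨?_, hr⟩
    rintro (n | n | n)
    · rcases n with - | n
      · exact le_rfl
      · exact part_sub_part_nonneg hx n
    · rcases n with - | n
      · exact le_rfl
      · exact part_sub_part_nonneg hy n
    · rcases le_or_gt n r with h | h
      · rw [hdom, sub_nonneg]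
        exact_mod_cast hd n h
      · rw [facetForm_dom_of_le h.le, hr]

theorem kostkaPoints_eq : kostkaPoints r =
    {p | p ∈ cone r ∧ ∃ x y : Fin r → ℕ, p = (fun i => (x i : ℝ), fun i => (y i : ℝ))} := by
  ext p
  constructor
  · rintro ⟨x, y, h1, h2, h3, h4, rfl⟩
    exact ⟨natCast_mem_cone_iff.2 ⟨h1, h2, h3, h4⟩, x, y, rfl⟩
  · rintro ⟨h, x, y, rfl⟩
    obtain ⟨h1, h2, h3, h4⟩ := natCast_mem_cone_iff.1 h
    exact ⟨x, y, h1, h2, h3, h4, rfl⟩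

theorem zero_mem_kostkaPoints : (0 : KostkaSpace r) ∈ kostkaPoints r := by
  rw [kostkaPoints_eq]
  exact ⟨zero_mem_cone, 0, 0, by ext <;> simp⟩

theorem add_mem_kostkaPoints {p q : KostkaSpace r} (hp : p ∈ kostkaPoints r)
    (hq : q ∈ kostkaPoints r) : p + q ∈ kostkaPoints r := by
  rw [kostkaPoints_eq] at *
  obtain ⟨h, x, y, rfl⟩ := hp
  obtain ⟨h', x', y', rfl⟩ := hq
  exact ⟨add_mem_cone h h', x + x', y + y', by ext <;> simp⟩

theorem natCast_smul_mem_kostkaPoints (N : ℕ) {p : KostkaSpace r} (hp : p ∈ kostkaPoints r) :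
    (N : ℝ) • p ∈ kostkaPoints r := by
  rw [kostkaPoints_eq] at *
  obtain ⟨h, x, y, rfl⟩ := hp
  exact ⟨smul_mem_cone h (Nat.cast_nonneg N), fun i => N * x i, fun i => N * y i, by
    ext <;> simp⟩

theorem gen_mem_kostkaPoints {t : KostkaLabel} (ht : Valid t) (ha : t.a ≤ r) :
    gen r t ∈ kostkaPoints r := by
  rw [kostkaPoints_eq]
  refine ⟨gen_mem_cone ht ha, ?_⟩
  obtain ⟨l, hl, hl1, hl2⟩ : ∃ l, (if t.ℓ < t.b then t.ℓ else 0) = l ∧ l ≤ t.b ∧ l ≤ t.a := by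
    refine ⟨_, rfl, ?_⟩
    have := ht.le_a
    split_ifs <;> omega
  refine ⟨fun i => if (i : ℕ) < t.b then t.a - l else 0,
    fun i => if (i : ℕ) < l then t.a - l else if (i : ℕ) < t.a then t.b - l else 0, ?_⟩
  unfold gen
  rw [hl]
  ext i <;> simp only [rayGenerator] <;> push_cast [hl1, hl2] <;> rfl

theorem zero_mem_kostkaCone : (0 : KostkaSpace r) ∈ kostkaCone r :=
  subset_convexHull ℝ _ zero_mem_kostkaPoints

open scoped Pointwise in
theorem add_mem_kostkaCone {p q : KostkaSpace r} (hp : p ∈ kostkaCone r)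
    (hq : q ∈ kostkaCone r) : p + q ∈ kostkaCone r := by
  have h : p + q ∈ convexHull ℝ (kostkaPoints r + kostkaPoints r) := by
    rw [convexHull_add]
    exact Set.add_mem_add hp hq
  refine convexHull_mono ?_ h
  rintro _ ⟨x, hx, y, hy, rfl⟩
  exact add_mem_kostkaPoints hx hy

open scoped Pointwise in
theorem smul_mem_kostkaCone {p : KostkaSpace r} (hp : p ∈ kostkaCone r) {c : ℝ} (hc : 0 ≤ c) :
    c • p ∈ kostkaCone r := by
  -- The integer points are closed only under integer multiples; so overshoot to `N ≥ c` and shrink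
  -- towards the origin by convexity.
  obtain ⟨N, hN⟩ := exists_nat_ge (max c 1)
  have hN0 : (0 : ℝ) < N := lt_of_lt_of_le one_pos ((le_max_right _ _).trans hN)
  have hNp : (N : ℝ) • p ∈ kostkaCone r := by
    have h : (N : ℝ) • p ∈ convexHull ℝ ((N : ℝ) • kostkaPoints r) := by
      rw [convexHull_smul]
      exact Set.smul_mem_smul_set hp
    refine convexHull_mono ?_ h
    rintro _ ⟨x, hx, rfl⟩
    exact natCast_smul_mem_kostkaPoints N hx
  have h := (convex_convexHull ℝ (kostkaPoints r)).smul_mem_of_zero_mem zero_mem_kostkaCone hNp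
    (t := c / N) ⟨by positivity, (div_le_one hN0).2 ((le_max_left _ _).trans hN)⟩
  rwa [smul_smul, div_mul_cancel₀ _ hN0.ne'] at h

theorem kostkaCone_eq : kostkaCone r = cone r := by
  apply Set.Subset.antisymm
  · refine convexHull_min ?_ convex_cone
    rw [kostkaPoints_eq]
    exact fun p hp => hp.1
  · intro p hp
    refine Submodule.span_induction (p := fun q _ => q ∈ kostkaCone r) ?_ ?_ ?_ ?_
      (mem_span_gen hp)
    · rintro _ ⟨t, ht, rfl⟩
      exact subset_convexHull ℝ _ (gen_mem_kostkaPoints ht.1 (a_le_of_mem_labels_strictAt ht))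
    · exact zero_mem_kostkaCone
    · exact fun x y _ _ hx hy => add_mem_kostkaCone hx hy
    · exact fun c x _ hx => smul_mem_kostkaCone hx c.2

theorem mem_kostkaPolytope {p : KostkaSpace r} :
    p ∈ kostkaPolytope r ↔ p ∈ cone r ∧ size r p = 1 := by
  rw [size_apply, ← kostkaCone_eq]
  rfl

end integer

open Filter Topology

/-! ### The dimension of a face of the cone -/

section dimension

variable {r : ℕ} {A : Set Facet}

/-- The points at which all the linear forms outside `A` vanish. -/
def faceSpace (r : ℕ) (A : Set Facet) : Submodule ℝ (KostkaSpace r) where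
  carrier := {v | ∀ f, f ∉ A → facetForm r f v = 0}
  add_mem' hx hy f hf := by rw [map_add, hx f hf, hy f hf, add_zero]
  zero_mem' f _ := map_zero _
  smul_mem' c x hx f hf := by rw [map_smul, hx f hf, smul_zero]

/-- With the next two lemmas: if neither `mu n` nor `dom n` is in `A`, for `n > 0`, then neither are
`lam n` and the dominance inequalities next to `n`. The second difference relation then makes the
form `mu n` vanish by itself. -/
theorem Facial.mu_mem_of_lam_mem (hA : Facial A) {n : ℕ} (h : Facet.lam n ∈ A)
    (hd : Facet.dom n ∉ A) : Facet.mu n ∈ A := by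
  obtain ⟨t, ht, hn⟩ := hA _ h
  rw [lam_mem_labelSupport] at hn
  subst hn
  rcases ht.1 with hp | hp
  · exact absurd (dom_mem ht hp.1 hp.2) hd
  · rw [hp.1]
    exact mu_a_mem ht

theorem Facial.mu_mem_of_dom_succ_mem (hA : Facial A) {n : ℕ} (h0 : 0 < n)
    (h : Facet.dom (n + 1) ∈ A) (hd : Facet.dom n ∉ A) : Facet.mu n ∈ A := by
  obtain ⟨t, ht, h1, h2⟩ := hA _ h
  have : t.ℓ = n := by
    by_contra hne
    exact hd (dom_mem ht (by omega) (by omega))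
  exact this ▸ mu_l_mem ht (by omega)

theorem Facial.mu_succ_mem_of_dom_mem (hA : Facial A) {n : ℕ} (h : Facet.dom n ∈ A)
    (hd : Facet.dom (n + 1) ∉ A) : Facet.mu (n + 1) ∈ A := by
  obtain ⟨t, ht, h1, h2⟩ := hA _ h
  have : t.a = n + 1 := by
    by_contra hne
    exact hd (dom_mem ht (by omega) (by omega))
  exact this ▸ mu_a_mem ht

theorem Facial.lt_of_dom_mem (hA : Facial A) (hr : indices A ⊆ Set.Icc 1 r) {n : ℕ}
    (h : Facet.dom n ∈ A) : n < r := by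
  obtain ⟨t, ht, h1, h2⟩ := hA _ h
  exact h2.trans_le (hr (a_mem_indices ht)).2

/-- A sequence supported on a set of indices, with vanishing second differences there, is zero. -/
theorem eq_zero_of_second_difference {D : ℕ → ℝ} {S : Set ℕ} (h0 : 0 ∉ S) (hr : ∀ n ∈ S, n < r)
    (hD : ∀ n, n ∉ S → D n = 0)
    (h2 : ∀ n, n + 1 ∈ S → D (n + 2) - 2 * D (n + 1) + D n = 0) (n : ℕ) : D n = 0 := by
  have key : ∀ E : ℕ → ℝ, (∀ n, n ∉ S → E n = 0) →
      (∀ n, n + 1 ∈ S → E (n + 2) - 2 * E (n + 1) + E n = 0) → ∀ n, E n ≤ 0 := by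
    intro E hE hE2 n
    by_contra hn
    obtain ⟨m, hm1, hm2⟩ := exists_peak (hE 0 h0)
      (fun k hk => hE k fun hS => absurd (hr k hS) (not_lt.2 hk)) (not_le.1 hn)
    have hmS : m + 1 ∈ S := by
      by_contra hS
      exact hm1.ne' (hE _ hS)
    exact hm2.ne (hE2 m hmS)
  refine le_antisymm (key D hD h2 n) ?_
  have := key (fun n => -D n) (fun n hn => by rw [hD n hn, neg_zero])
    (fun n hn => by linarith [h2 n hn]) n
  linarith

/-- The Dirichlet problem for second differences on a finite set of indices. -/
theorem exists_second_difference {S : Set ℕ} (h0 : 0 ∉ S) (hr : ∀ n ∈ S, n < r) (g : ℕ → ℝ) :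
    ∃ D : ℕ → ℝ, (∀ n, n ∉ S → D n = 0) ∧
      ∀ n, n + 1 ∈ S → D (n + 2) - 2 * D (n + 1) + D n = g (n + 1) := by
  classical
  have hfin : Finite S := ((Set.finite_Iio r).subset hr).to_subtype
  let E : (S → ℝ) →ₗ[ℝ] (ℕ → ℝ) := Function.ExtendByZero.linearMap ℝ Subtype.val
  have hE : ∀ D n, n ∉ S → E D n = 0 := fun D n hn =>
    Function.extend_apply' _ _ _ fun ⟨a, ha⟩ => hn (ha ▸ a.2)
  have hE' : ∀ D (n : S), E D n = D n := fun D n =>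
    Subtype.val_injective.extend_apply D 0 n
  let L : (S → ℝ) →ₗ[ℝ] (S → ℝ) := LinearMap.pi fun n =>
    (LinearMap.proj ((n : ℕ) + 1) - (2 : ℝ) • LinearMap.proj (n : ℕ) +
      LinearMap.proj ((n : ℕ) - 1)) ∘ₗ E
  have hL : ∀ D n (hn : n + 1 ∈ S), L D ⟨n + 1, hn⟩ =
      E D (n + 2) - 2 * E D (n + 1) + E D n := fun D n hn => by
    simp [L]
  have hinj : Function.Injective L := by
    rw [← LinearMap.ker_eq_bot, LinearMap.ker_eq_bot']
    intro D hD
    funext n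
    rw [← hE' D n]
    refine eq_zero_of_second_difference (D := E D) h0 hr (hE D) (fun n hn => ?_) n
    rw [← hL D n hn, hD]
    rfl
  -- The system is square, so uniqueness, which is the discrete maximum principle, gives existence.
  obtain ⟨D, hD⟩ := LinearMap.injective_iff_surjective.1 hinj fun n => g n
  refine ⟨E D, hE D, fun n hn => ?_⟩
  rw [← hL D n hn, hD]

theorem part_eq_of_vanishing {g : ℕ → ℝ} (hg : ∀ n, r ≤ n → g n = 0) (n : ℕ) :
    part n (fun i : Fin r => g i) = g n := by
  by_cases h : n < r
  · rw [part_of_lt h]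
  · rw [part_of_le (by omega), hg n (by omega)]

/-- A point of the ambient space is given by the descents of the first tuple and the differences
of partial sums. -/
theorem exists_of_lam_dom {x D : ℕ → ℝ} (hx0 : x 0 = 0) (hx : ∀ n, r < n → x n = 0)
    (hD0 : D 0 = 0) (hD : ∀ n, r ≤ n → D n = 0) :
    ∃ v : KostkaSpace r, (∀ n, facetForm r (.lam n) v = x n) ∧
      ∀ n, facetForm r (.dom n) v = D n := by
  let g : ℕ → ℝ := fun n => ∑ j ∈ Finset.Ioc n r, x j
  let h : ℕ → ℝ := fun n => g n - (D (n + 1) - D n)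
  have hg : ∀ n, r ≤ n → g n = 0 := fun n hn => by
    simp only [g]
    rw [Finset.Ioc_eq_empty (by omega), Finset.sum_empty]
  have hh : ∀ n, r ≤ n → h n = 0 := fun n hn => by
    simp only [h]
    rw [hg n hn, hD n hn, hD (n + 1) (by omega)]
    ring
  let v : KostkaSpace r := (fun i => g i, fun i => h i)
  have hv1 : ∀ n, part n v.1 = g n := part_eq_of_vanishing hg
  have hv2 : ∀ n, part n v.2 = h n := part_eq_of_vanishing hh
  refine ⟨v, fun n => ?_, fun n => ?_⟩
  · rcases n with - | n
    · rw [facetForm_lam_zero, hx0]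
    · rw [facetForm_lam_succ, hv1, hv1]
      rcases lt_or_ge n r with hn | hn
      · have : Finset.Ioc n r = insert (n + 1) (Finset.Ioc (n + 1) r) := by
          ext k
          simp only [Finset.mem_insert, Finset.mem_Ioc]
          omega
        simp only [g]
        rw [this, Finset.sum_insert (by simp)]
        ring
      · rw [hg n hn, hg _ (by omega), hx _ (by omega), sub_zero]
  · induction n with
    | zero => rw [facetForm_dom_zero, hD0]
    | succ n ih =>
      rw [facetForm_dom_succ, ih, hv1, hv2]
      simp only [h]
      ring

/-- The values of `lam` on `lamIdx A` and of `mu` on `innerMuIdx A` are linear coordinates. They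
prescribe the second difference of `D` wherever `dom` is in `A`, and `D` is zero elsewhere, so the
Dirichlet problem determines `D` and then every remaining `mu`. -/
theorem Facial.finrank_faceSpace (hA : Facial A) (hr : indices A ⊆ Set.Icc 1 r) :
    Module.finrank ℝ (faceSpace r A) = weight A := by
  classical
  have hfin : (indices A).Finite := (Set.finite_Icc 1 r).subset hr
  have : Fintype (lamIdx A) := (finite_lamIdx hfin).fintype
  have : Fintype (innerMuIdx A) := (finite_innerMuIdx hfin).fintype
  let S : Set ℕ := {n | Facet.dom n ∈ A}
  have hS0 : 0 ∉ S := hA.not_dom_zero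
  have hSr : ∀ n ∈ S, n < r := fun n hn => hA.lt_of_dom_mem hr hn
  let T : faceSpace r A →ₗ[ℝ] (lamIdx A → ℝ) × (innerMuIdx A → ℝ) :=
    (LinearMap.prod (LinearMap.pi fun n => facetForm r (.lam n))
      (LinearMap.pi fun n => facetForm r (.mu n))) ∘ₗ (faceSpace r A).subtype
  have hinj : Function.Injective T := by
    rw [← LinearMap.ker_eq_bot, LinearMap.ker_eq_bot']
    rintro ⟨v, hv⟩ hT
    have hl : ∀ n, facetForm r (.lam n) v = 0 := fun n => by
      by_cases hn : Facet.lam n ∈ A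
      · exact congrFun (congrArg Prod.fst hT) ⟨n, hn⟩
      · exact hv _ hn
    have hm : ∀ n, Facet.dom n ∈ A → facetForm r (.mu n) v = 0 := fun n hd => by
      by_cases hn : Facet.mu n ∈ A
      · exact congrFun (congrArg Prod.snd hT) ⟨n, hn, hd⟩
      · exact hv _ hn
    have hD : ∀ n, facetForm r (.dom n) v = 0 :=
      eq_zero_of_second_difference (D := fun n => facetForm r (.dom n) v) hS0 hSr
        (fun n hn => hv _ hn) fun n hn => by
          rw [facetForm_dom_second_difference, hl, hm _ hn, sub_zero]
    refine Subtype.ext (eq_zero_of_facetForm hl fun n => ?_)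
    rcases n with - | n
    · rfl
    · have := facetForm_dom_second_difference n v
      rw [hD, hD, hD, hl] at this
      linarith
  have hsurj : Function.Surjective T := by
    rintro ⟨x, y⟩
    let xh : ℕ → ℝ := fun n => if h : n ∈ lamIdx A then x ⟨n, h⟩ else 0
    let yh : ℕ → ℝ := fun n => if h : n ∈ innerMuIdx A then y ⟨n, h⟩ else 0
    have hxh : ∀ n, Facet.lam n ∉ A → xh n = 0 := fun n hn => dif_neg hn
    have hyh : ∀ n, n ∉ innerMuIdx A → yh n = 0 := fun n hn => dif_neg hn
    obtain ⟨D, hD1, hD2⟩ := exists_second_difference hS0 hSr fun n => yh n - xh n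
    obtain ⟨v, hv1, hv2⟩ := exists_of_lam_dom (r := r) (x := xh) (D := D)
      (hxh 0 fun h => absurd (hr (Or.inl h)).1 (by omega))
      (fun n hn => hxh n fun h => absurd (hr (Or.inl h)).2 (by omega))
      (hD1 0 hS0) (fun n hn => hD1 n fun h => absurd (hSr n h) (by omega))
    have hmu : ∀ n, facetForm r (.mu (n + 1)) v =
        xh (n + 1) + (D (n + 2) - 2 * D (n + 1) + D n) := fun n => by
      have := facetForm_dom_second_difference n v
      rw [hv1, hv2, hv2, hv2] at this
      linarith
    have hmu' : ∀ n, Facet.dom (n + 1) ∈ A → facetForm r (.mu (n + 1)) v = yh (n + 1) :=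
      fun n hn => by
        rw [hmu, hD2 n hn]
        ring
    have hv : v ∈ faceSpace r A := by
      rintro (n | n | n) hn
      · rw [hv1, hxh n hn]
      · rcases n with - | n
        · rfl
        · by_cases hd : Facet.dom (n + 1) ∈ A
          · rw [hmu' n hd]
            exact hyh _ fun h => hn h.1
          · rw [hmu, hxh _ fun h => hn (hA.mu_mem_of_lam_mem h hd), hD1 (n + 1) hd,
              hD1 (n + 2) fun h => hn (hA.mu_mem_of_dom_succ_mem (Nat.succ_pos n) h hd),
              hD1 n fun h => hn (hA.mu_succ_mem_of_dom_mem h hd)]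
            ring
      · rw [hv2]
        exact hD1 n hn
    refine ⟨⟨v, hv⟩, Prod.ext (funext fun n => ?_) (funext fun n => ?_)⟩
    · change facetForm r (.lam n) v = x n
      rw [hv1]
      exact dif_pos n.2
    · obtain ⟨n, hn1, hn2⟩ := n
      obtain ⟨m, rfl⟩ : ∃ m, n = m + 1 :=
        Nat.exists_eq_succ_of_ne_zero fun h => hS0 (h ▸ hn2)
      change facetForm r (.mu (m + 1)) v = y _
      rw [hmu' m hn2]
      exact dif_pos ⟨hn1, hn2⟩
  rw [(LinearEquiv.ofBijective T ⟨hinj, hsurj⟩).finrank_eq, Module.finrank_prod,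
    Module.finrank_fintype_fun_eq_card, Module.finrank_fintype_fun_eq_card, weight,
    ← Nat.card_coe_set_eq, ← Nat.card_coe_set_eq, Nat.card_eq_fintype_card,
    Nat.card_eq_fintype_card]

end dimension

/-! ### Faces of the polytope and facial sets -/

section faces

variable {r : ℕ} {A : Set Facet}

/-- The face of the polytope on which the inequalities outside `A` are tight. -/
def face (r : ℕ) (A : Set Facet) : Set (KostkaSpace r) :=
  {p | p ∈ kostkaPolytope r ∧ strictAt p ⊆ A}

theorem convex_kostkaPolytope : Convex ℝ (kostkaPolytope r) := by
  intro p hp q hq a b ha hb hab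
  rw [mem_kostkaPolytope] at *
  refine ⟨convex_cone hp.1 hq.1 ha hb hab, ?_⟩
  rw [map_add, map_smul, map_smul, hp.2, hq.2, ← add_smul, hab, one_smul]

/-- Only finitely many inequalities are strict at `p`, and they survive a small move; the tight ones
do not change along `v`. -/
theorem exists_perturbation_mem_cone {p v : KostkaSpace r} (hp : p ∈ cone r)
    (hv : v ∈ faceSpace r (strictAt p)) : ∃ c : ℝ, 0 < c ∧ p + c • v ∈ cone r := by
  have hev : ∀ f ∈ strictAt p, ∀ᶠ c : ℝ in 𝓝[>] 0, 0 < facetForm r f p + c * facetForm r f v := by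
    intro f hf
    have hcont : Tendsto (fun c : ℝ => facetForm r f p + c * facetForm r f v) (𝓝[>] 0)
        (𝓝 (facetForm r f p + 0 * facetForm r f v)) :=
      (Continuous.tendsto (by fun_prop) 0).mono_left nhdsWithin_le_nhds
    rw [zero_mul, add_zero] at hcont
    exact hcont.eventually (lt_mem_nhds hf)
  obtain ⟨c, hc, hc0⟩ := (((Filter.eventually_all_finite (finite_strictAt hp)).2 hev).and
    self_mem_nhdsWithin).exists
  have hval : ∀ f, facetForm r f (p + c • v) = facetForm r f p + c * facetForm r f v := fun f => by
    rw [map_add, map_smul, smul_eq_mul]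
  refine ⟨c, hc0, fun f => ?_, ?_⟩
  · rw [hval]
    by_cases hf : f ∈ strictAt p
    · exact (hc f hf).le
    · rw [hv f hf, mul_zero, add_zero]
      exact hp.1 f
  · have hr : Facet.dom r ∉ strictAt p := (facetForm_eq_zero_iff hp).1 hp.2
    rw [hval, hp.2, hv _ hr, mul_zero, add_zero]

theorem strictAt_subset_iff {p : KostkaSpace r} (hp : p ∈ cone r) :
    strictAt p ⊆ A ↔ p ∈ faceSpace r A :=
  ⟨fun h f hf => (facetForm_eq_zero_iff hp).2 fun h' => hf (h h'), fun h f hf => by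
    by_contra hfA
    exact (facetForm_eq_zero_iff hp).1 (h f hfA) hf⟩

theorem strictAt_smul {p : KostkaSpace r} {c : ℝ} (hc : 0 < c) :
    strictAt (c • p) = strictAt p := by
  ext f
  change 0 < facetForm r f (c • p) ↔ 0 < facetForm r f p
  rw [map_smul, smul_eq_mul, mul_pos_iff_of_pos_left hc]

theorem strictAt_add {p q : KostkaSpace r} (hp : p ∈ cone r) (hq : q ∈ cone r) :
    strictAt (p + q) = strictAt p ∪ strictAt q := by
  ext f
  have h1 := hp.1 f
  have h2 := hq.1 f
  change 0 < facetForm r f (p + q) ↔ 0 < facetForm r f p ∨ 0 < facetForm r f q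
  rw [map_add]
  constructor
  · intro h
    by_contra hno
    push Not at hno
    linarith
  · rintro (h | h) <;> linarith

theorem normalize_mem_kostkaPolytope {p : KostkaSpace r} (hp : p ∈ cone r) (h0 : p ≠ 0) :
    (size r p)⁻¹ • p ∈ kostkaPolytope r := by
  have hs := size_pos hp h0
  rw [mem_kostkaPolytope]
  refine ⟨smul_mem_cone hp (inv_pos.2 hs).le, ?_⟩
  rw [map_smul, smul_eq_mul, inv_mul_cancel₀ hs.ne']

/-- Every nonempty facial set consists of the strict inequalities at some point of the
polytope. -/
theorem Facial.exists_strictAt_eq (hA : Facial A) (hr : indices A ⊆ Set.Icc 1 r)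
    (hne : A.Nonempty) : ∃ z ∈ kostkaPolytope r, strictAt z = A := by
  classical
  have hfin : A.Finite := (finite_facetsUpTo r).subset (hA.subset_facetsUpTo hr)
  have : Nonempty KostkaLabel := ⟨⟨0, 0, 0⟩⟩
  choose! τ hτ hτ' using hA
  have hle : ∀ f ∈ A, (τ f).a ≤ r := fun f hf => (hr (a_mem_indices (hτ f hf))).2
  have hcone : ∀ s : Finset Facet, ↑s ⊆ A → ∑ f ∈ s, gen r (τ f) ∈ cone r ∧
      strictAt (∑ f ∈ s, gen r (τ f)) = ⋃ f ∈ s, labelSupport (τ f) := by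
    intro s
    induction s using Finset.induction_on with
    | empty =>
      intro _
      refine ⟨by simpa using zero_mem_cone, ?_⟩
      ext f
      simp [strictAt]
    | insert f s hfs ih =>
      intro hs
      have hfA : f ∈ A := hs (by simp)
      obtain ⟨h1, h2⟩ := ih fun g hg => hs (by simp [Finset.mem_coe.1 hg])
      have hg := gen_mem_cone (hτ f hfA).1 (hle f hfA)
      rw [Finset.sum_insert hfs]
      refine ⟨add_mem_cone hg h1, ?_⟩
      rw [strictAt_add hg h1, h2, strictAt_gen (hτ f hfA).1 (hle f hfA),
        Finset.set_biUnion_insert]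
  obtain ⟨h1, h2⟩ := hcone hfin.toFinset (by simp)
  have hz : strictAt (∑ f ∈ hfin.toFinset, gen r (τ f)) = A := by
    rw [h2]
    ext f
    simp only [Set.Finite.mem_toFinset, Set.mem_iUnion, exists_prop]
    exact ⟨fun ⟨g, hg, hf⟩ => (hτ g hg).2 hf, fun hf => ⟨f, hf, hτ' f hf⟩⟩
  have h0 : ∑ f ∈ hfin.toFinset, gen r (τ f) ≠ 0 := by
    intro h
    obtain ⟨f, hf⟩ := hne
    rw [← hz, h] at hf
    exact lt_irrefl (0 : ℝ) (hf.trans_eq (map_zero (facetForm r f)))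
  exact ⟨_, normalize_mem_kostkaPolytope h1 h0, by
    rw [strictAt_smul (inv_pos.2 (size_pos h1 h0)), hz]⟩

/-- A nonempty convex subset of the polytope has a point at which as many inequalities as possible
are strict. -/
theorem exists_strictAt_maximal {F : Set (KostkaSpace r)} (hF : F ⊆ kostkaPolytope r)
    (hc : Convex ℝ F) (hne : F.Nonempty) : ∃ z ∈ F, ∀ p ∈ F, strictAt p ⊆ strictAt z := by
  have hcone : ∀ p ∈ F, p ∈ cone r := fun p hp => (mem_kostkaPolytope.1 (hF hp)).1
  have hfin : (strictAt '' F).Finite := by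
    refine (finite_facetsUpTo r).finite_subsets.subset ?_
    rintro _ ⟨p, hp, rfl⟩
    exact strictAt_subset_facetsUpTo (hcone p hp)
  obtain ⟨_, ⟨z, hz, rfl⟩, hmax⟩ := Set.exists_max_image (strictAt '' F) Set.ncard hfin
    (hne.image _)
  refine ⟨z, hz, fun p hp => ?_⟩
  -- The midpoint is strict wherever either endpoint is, so a maximal strict set contains all
  -- others.
  have hm : (1 / 2 : ℝ) • p + (1 / 2 : ℝ) • z ∈ F :=
    hc hp hz (by norm_num) (by norm_num) (by norm_num)
  have hs : strictAt ((1 / 2 : ℝ) • p + (1 / 2 : ℝ) • z) = strictAt p ∪ strictAt z := by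
    rw [strictAt_add (smul_mem_cone (hcone p hp) (by norm_num))
      (smul_mem_cone (hcone z hz) (by norm_num)), strictAt_smul (by norm_num),
      strictAt_smul (by norm_num)]
  have hle := hmax _ ⟨_, hm, rfl⟩
  rw [hs] at hle
  have := Set.eq_of_subset_of_ncard_le (Set.subset_union_right (s := strictAt p)) hle
    ((finite_strictAt (hcone p hp)).union (finite_strictAt (hcone z hz)))
  rw [this]
  exact Set.subset_union_left

/-- The exposing functional is minus the sum of the forms outside `A`, restricted to the finitely
many that can be strict on the cone. -/
theorem isExposed_face (A : Set Facet) : IsExposed ℝ (kostkaPolytope r) (face r A) := by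
  classical
  rintro ⟨z, hz, hzA⟩
  set G : Finset Facet := (finite_facetsUpTo r).toFinset.filter (· ∉ A) with hG
  set l : KostkaSpace r →ₗ[ℝ] ℝ := -∑ f ∈ G, facetForm r f with hl
  have hlv : ∀ p, l p = -∑ f ∈ G, facetForm r f p := fun p => by
    rw [hl, LinearMap.neg_apply, LinearMap.sum_apply]
  have hle : ∀ p ∈ kostkaPolytope r, l p ≤ 0 := fun p hp => by
    rw [hlv, neg_nonpos]
    exact Finset.sum_nonneg fun f _ => (mem_kostkaPolytope.1 hp).1.1 f
  have heq : ∀ p ∈ kostkaPolytope r, l p = 0 ↔ strictAt p ⊆ A := fun p hp => by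
    have hpc := (mem_kostkaPolytope.1 hp).1
    rw [hlv, neg_eq_zero, Finset.sum_eq_zero_iff_of_nonneg fun f _ => hpc.1 f]
    constructor
    · intro h f hf
      by_contra hfA
      exact (facetForm_eq_zero_iff hpc).1 (h f (Finset.mem_filter.2
        ⟨(Set.Finite.mem_toFinset _).2 (strictAt_subset_facetsUpTo hpc hf), hfA⟩)) hf
    · intro h f hf
      exact (facetForm_eq_zero_iff hpc).2 fun h' => (Finset.mem_filter.1 hf).2 (h h')
  refine ⟨LinearMap.toContinuousLinearMap l, ?_⟩
  ext p
  constructor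
  · rintro ⟨hp, hpA⟩
    refine ⟨hp, fun q hq => ?_⟩
    change l q ≤ l p
    rw [(heq p hp).2 hpA]
    exact hle q hq
  · rintro ⟨hp, hmax⟩
    have h1 : l z ≤ l p := hmax z hz
    rw [(heq z hz).2 hzA] at h1
    exact ⟨hp, (heq p hp).1 (le_antisymm (hle p hp) h1)⟩

/-- The nonempty exposed faces of the polytope are cut out by facial sets. -/
theorem exists_eq_face {F : Set (KostkaSpace r)} (hF : IsExposed ℝ (kostkaPolytope r) F)
    (hne : F.Nonempty) : ∃ z ∈ kostkaPolytope r, F = face r (strictAt z) := by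
  obtain ⟨z, hz, hmax⟩ := exists_strictAt_maximal hF.subset
    (hF.convex convex_kostkaPolytope) hne
  have hzP := hF.subset hz
  refine ⟨z, hzP, Set.Subset.antisymm (fun p hp => ⟨hF.subset hp, hmax p hp⟩) ?_⟩
  rintro x ⟨hx, hxz⟩
  obtain ⟨l, rfl⟩ := hF hne
  rw [mem_kostkaPolytope] at hx hzP
  have hv : z - x ∈ faceSpace r (strictAt z) :=
    Submodule.sub_mem _ ((strictAt_subset_iff hzP.1).1 le_rfl) ((strictAt_subset_iff hx.1).1 hxz)
  obtain ⟨c, hc, hcone⟩ := exists_perturbation_mem_cone hzP.1 hv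
  -- The segment from `x` to `z` can be prolonged beyond `z` inside the polytope, so a functional
  -- maximal at `z` cannot be smaller at `x`.
  have hmem : z + c • (z - x) ∈ kostkaPolytope r := by
    rw [mem_kostkaPolytope]
    refine ⟨hcone, ?_⟩
    rw [map_add, map_smul, map_sub, hzP.2, hx.2]
    simp
  have h1 := hz.2 _ hmem
  rw [map_add, map_smul, map_sub, smul_eq_mul] at h1
  have h2 : l z ≤ l x := by
    by_contra hlt
    have := mul_pos hc (sub_pos.2 (not_le.1 hlt))
    linarith
  exact ⟨mem_kostkaPolytope.2 hx, fun y hy => (hz.2 y hy).trans h2⟩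

theorem vectorSpan_face {z : KostkaSpace r} (hz : z ∈ kostkaPolytope r) :
    vectorSpan ℝ (face r (strictAt z)) = faceSpace r (strictAt z) ⊓ LinearMap.ker (size r) := by
  have hzc := mem_kostkaPolytope.1 hz
  apply le_antisymm
  · rw [vectorSpan_def, Submodule.span_le]
    rintro _ ⟨p, ⟨hp, hpz⟩, q, ⟨hq, hqz⟩, rfl⟩
    rw [mem_kostkaPolytope] at hp hq
    refine ⟨Submodule.sub_mem _ ((strictAt_subset_iff hp.1).1 hpz)
      ((strictAt_subset_iff hq.1).1 hqz), ?_⟩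
    change size r (p - q) = 0
    rw [map_sub, hp.2, hq.2, sub_self]
  · rintro v ⟨hv1, hv2⟩
    have hv2' : size r v = 0 := hv2
    obtain ⟨c, hc, hcone⟩ := exists_perturbation_mem_cone hzc.1 hv1
    have hmem : z + c • v ∈ face r (strictAt z) := by
      refine ⟨mem_kostkaPolytope.2 ⟨hcone, ?_⟩, ?_⟩
      · rw [map_add, map_smul, hv2', hzc.2]
        simp
      · rw [strictAt_subset_iff hcone]
        exact Submodule.add_mem _ ((strictAt_subset_iff hzc.1).1 le_rfl)
          (Submodule.smul_mem _ _ hv1)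
    have h := vsub_mem_vectorSpan ℝ hmem (⟨hz, le_rfl⟩ : z ∈ face r (strictAt z))
    rw [vsub_eq_sub, add_sub_cancel_left] at h
    have h' := Submodule.smul_mem _ c⁻¹ h
    rwa [smul_smul, inv_mul_cancel₀ hc.ne', one_smul] at h'

/-- The directions of the face are the kernel of `size` on `faceSpace`, of codimension one because
`size` is `1` at `z`. -/
theorem finrank_vectorSpan_face {z : KostkaSpace r} (hz : z ∈ kostkaPolytope r) :
    Module.finrank ℝ (vectorSpan ℝ (face r (strictAt z))) + 1 = weight (strictAt z) := by
  have hzc := mem_kostkaPolytope.1 hz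
  rw [← (facial_strictAt hzc.1).finrank_faceSpace (indices_strictAt_subset z),
    vectorSpan_face hz]
  set W := faceSpace r (strictAt z) with hW
  have h := LinearMap.finrank_range_add_finrank_ker ((size r) ∘ₗ W.subtype)
  have hsurj : LinearMap.range ((size r) ∘ₗ W.subtype) = ⊤ := by
    rw [LinearMap.range_eq_top]
    intro c
    refine ⟨c • ⟨z, (strictAt_subset_iff hzc.1).1 le_rfl⟩, ?_⟩
    rw [map_smul]
    change c • size r z = c
    rw [hzc.2, smul_eq_mul, mul_one]
  rw [hsurj, finrank_top, Module.finrank_self, LinearMap.ker_comp,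
    ← Submodule.finrank_map_subtype_eq, Submodule.map_comap_subtype, add_comm] at h
  exact h

theorem weight_empty : weight ∅ = 0 := by
  simp [weight, lamIdx, innerMuIdx]

theorem exists_strictAt_eq_of_mem_facialUpTo {d : ℕ} (hA : A ∈ facialUpTo d r) :
    ∃ z ∈ kostkaPolytope r, strictAt z = A := by
  refine hA.1.exists_strictAt_eq hA.2.2 ?_
  rw [Set.nonempty_iff_ne_empty]
  rintro rfl
  have := hA.2.1
  rw [weight_empty] at this
  omega

theorem kostkaFaces_eq (r d : ℕ) : kostkaFaces r d = face r '' facialUpTo d r := by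
  ext F
  constructor
  · rintro ⟨hF, hne, hd⟩
    obtain ⟨z, hz, rfl⟩ := exists_eq_face hF hne
    refine ⟨strictAt z, ⟨facial_strictAt (mem_kostkaPolytope.1 hz).1, ?_,
      indices_strictAt_subset z⟩, rfl⟩
    rw [← finrank_vectorSpan_face hz, hd]
  · rintro ⟨A, hA, rfl⟩
    obtain ⟨z, hz, rfl⟩ := exists_strictAt_eq_of_mem_facialUpTo hA
    refine ⟨isExposed_face _, ⟨z, hz, le_rfl⟩, ?_⟩
    have := finrank_vectorSpan_face hz
    rw [hA.2.1] at this
    omega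

theorem injOn_face (r d : ℕ) : Set.InjOn (face r) (facialUpTo d r) := by
  have key : ∀ A ∈ facialUpTo d r, ∀ B, face r A = face r B → A ⊆ B := by
    intro A hA B h
    obtain ⟨z, hz, rfl⟩ := exists_strictAt_eq_of_mem_facialUpTo hA
    have : z ∈ face r B := h ▸ ⟨hz, le_rfl⟩
    exact this.2
  exact fun A hA B hB h => Set.Subset.antisymm (key A hA B h) (key B hB A h.symm)

theorem finite_kostkaFaces (r d : ℕ) : (kostkaFaces r d).Finite := by
  rw [kostkaFaces_eq]
  exact (finite_facialUpTo d r).image _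

theorem kostkaFaceNumber_eq_sum (d r : ℕ) :
    kostkaFaceNumber d r = ∑ k ∈ Finset.range (3 * d + 4), facialCount d k * r.choose k := by
  rw [kostkaFaceNumber, kostkaFaces_eq, (injOn_face r d).ncard_image, ncard_facialUpTo]

end faces

/-! ### Vertices, labels and top-degree faces -/

section vertices

variable {r : ℕ} {A : Set Facet} {t : KostkaLabel}

theorem gen_ne_zero (ht : Valid t) (ha : t.a ≤ r) : gen r t ≠ 0 := fun h => by
  have := facetForm_gen_pos ht ha (f := .lam t.b) rfl
  rw [h, map_zero] at this
  exact lt_irrefl _ this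

theorem size_gen_pos (ht : Valid t) (ha : t.a ≤ r) : 0 < size r (gen r t) :=
  size_pos (gen_mem_cone ht ha) (gen_ne_zero ht ha)

/-- The vertex of the polytope labeled by `t`. -/
noncomputable def vertex (r : ℕ) (t : KostkaLabel) : KostkaSpace r := (size r (gen r t))⁻¹ • gen r t

theorem vertex_mem_kostkaPolytope (ht : Valid t) (ha : t.a ≤ r) : vertex r t ∈ kostkaPolytope r :=
  normalize_mem_kostkaPolytope (gen_mem_cone ht ha) (gen_ne_zero ht ha)

theorem strictAt_vertex (ht : Valid t) (ha : t.a ≤ r) :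
    strictAt (vertex r t) = labelSupport t := by
  rw [vertex, strictAt_smul (inv_pos.2 (size_gen_pos ht ha)), strictAt_gen ht ha]

theorem weight_labelSupport (t : KostkaLabel) : weight (labelSupport t) = 1 := by
  have h1 : lamIdx (labelSupport t) = {t.b} := rfl
  have h2 : innerMuIdx (labelSupport t) = ∅ := by
    rw [Set.eq_empty_iff_forall_notMem]
    rintro n ⟨⟨-, h3⟩, h4, h5⟩
    omega
  rw [weight, h1, h2, Set.ncard_singleton, Set.ncard_empty]

/-- The support of one label has weight one, so the exposed face it cuts out has dimension zero and
is a single point. -/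
theorem vertex_mem_extremePoints (ht : Valid t) (ha : t.a ≤ r) :
    vertex r t ∈ (kostkaPolytope r).extremePoints ℝ := by
  have hP := vertex_mem_kostkaPolytope ht ha
  have hdim := finrank_vectorSpan_face hP
  rw [strictAt_vertex ht ha, weight_labelSupport, Nat.add_eq_right,
    Submodule.finrank_eq_zero] at hdim
  have hmem : vertex r t ∈ face r (labelSupport t) := ⟨hP, (strictAt_vertex ht ha).le⟩
  have hface : face r (labelSupport t) = {vertex r t} := by
    refine Set.eq_singleton_iff_unique_mem.2 ⟨hmem, fun p hp => ?_⟩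
    have h := vsub_mem_vectorSpan ℝ hp hmem
    rw [hdim, Submodule.mem_bot, vsub_eq_sub, sub_eq_zero] at h
    exact h
  rw [← isExtreme_singleton, ← hface]
  exact (isExposed_face _).isExtreme

theorem hasLabel_vertex (ht : Valid t) (ha : t.a ≤ r) : HasLabel r (vertex r t) t := by
  refine ⟨vertex_mem_extremePoints ht ha, ha, ?_⟩
  have hc := inv_pos.2 (size_gen_pos ht ha)
  have h0 := ht.pos_a
  rcases ht with hp | hd
  · refine Or.inl ⟨hp.1, hp.2, _, hc, ?_⟩
    rw [vertex, gen, if_pos hp.1]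
  · refine Or.inr ⟨hd.1, hd.2.1, 0, h0, _, hc, ?_⟩
    rw [vertex, gen, if_neg (by omega), hd.1]

theorem rayGenerator_self (r : ℕ) {a l : ℕ} (h : l < a) :
    rayGenerator r a a l = (((a : ℝ) - l) / a) • rayGenerator r a a 0 := by
  have h0 : (a : ℝ) ≠ 0 := by
    have : 0 < a := by omega
    positivity
  ext i
  · simp only [rayGenerator, Prod.smul_fst, Pi.smul_apply, smul_eq_mul]
    split_ifs <;> simp [h0]
  · simp only [rayGenerator, Prod.smul_snd, Pi.smul_apply, smul_eq_mul]
    split_ifs <;> first | omega | simp [h0]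

/-- The ray meets the hyperplane `size = 1` once, which fixes the scalar; in the degenerate case all
choices of `l` give the same ray. -/
theorem hasLabel_iff {v : KostkaSpace r} :
    HasLabel r v t ↔ Valid t ∧ t.a ≤ r ∧ v = vertex r t := by
  constructor
  · rintro ⟨hv, ha, h⟩
    have hvP := (mem_kostkaPolytope.1 (extremePoints_subset hv)).2
    have hval : Valid t := by
      rcases h with ⟨h1, h2, -⟩ | ⟨h1, h2, l, hl, -⟩
      · exact Or.inl ⟨h1, h2⟩
      · exact Or.inr ⟨h1, h2, by omega⟩
    obtain ⟨c, rfl⟩ : ∃ c : ℝ, v = c • gen r t := by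
      rcases h with ⟨h1, h2, c, -, rfl⟩ | ⟨h1, h2, l, hl, c, -, rfl⟩
      · exact ⟨c, by rw [gen, if_pos h1]⟩
      · refine ⟨c * (((t.a : ℝ) - l) / t.a), ?_⟩
        rw [gen, if_neg (by omega), h1, rayGenerator_self r hl, smul_smul]
    refine ⟨hval, ha, ?_⟩
    rw [map_smul, smul_eq_mul] at hvP
    rw [vertex, eq_inv_of_mul_eq_one_left hvP]
  · rintro ⟨ht, ha, rfl⟩
    exact hasLabel_vertex ht ha

theorem labelEntries_face (hr : indices A ⊆ Set.Icc 1 r) :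
    labelEntries r (face r A) = labelValues A := by
  ext n
  constructor
  · rintro ⟨v, hv, t, hvt, hn⟩
    obtain ⟨ht, ha, rfl⟩ := hasLabel_iff.1 hvt
    have h := (extremePoints_subset hv).2
    rw [strictAt_vertex ht ha] at h
    exact ⟨t, ⟨ht, h⟩, hn⟩
  · rintro ⟨t, ht, hn⟩
    have ha : t.a ≤ r := (hr (a_mem_indices ht)).2
    refine ⟨vertex r t, ?_, t, hasLabel_vertex ht.1 ha, hn⟩
    exact inter_extremePoints_subset_extremePoints_of_subset (fun p hp => hp.1)
      ⟨⟨vertex_mem_kostkaPolytope ht.1 ha, (strictAt_vertex ht.1 ha).le.trans ht.2⟩,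
        vertex_mem_extremePoints ht.1 ha⟩

open scoped Pointwise in
/-- A face is the convex hull of its vertices. -/
theorem face_eq_convexHull (hr : indices A ⊆ Set.Icc 1 r) :
    face r A = convexHull ℝ (vertex r '' labels A) := by
  have hle : ∀ t ∈ labels A, t.a ≤ r := fun t ht => (hr (a_mem_indices ht)).2
  apply Set.Subset.antisymm
  · rintro p ⟨hp, hpA⟩
    set K := convexHull ℝ (vertex r '' labels A) with hK
    have hKc : Convex ℝ K := convex_convexHull ℝ _
    have hsize : ∀ q ∈ K, size r q = 1 := fun q hq => by
      have hsub : K ⊆ kostkaPolytope r := by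
        refine convexHull_min ?_ convex_kostkaPolytope
        rintro _ ⟨t, ht, rfl⟩
        exact vertex_mem_kostkaPolytope ht.1 (hle t ht)
      exact (mem_kostkaPolytope.1 (hsub hq)).2
    have hpc := mem_kostkaPolytope.1 hp
    have hne : K.Nonempty := by
      have h0 : p ≠ 0 := by
        rintro rfl
        simpa using hpc.2
      obtain ⟨t, ht⟩ := exists_label_of_ne_zero hpc.1 h0
      exact ⟨_, subset_convexHull ℝ _ ⟨t, ⟨ht.1, ht.2.trans hpA⟩, rfl⟩⟩
    -- The conical combination of generators is rewritten as a multiple of a point of `K`; comparing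
    -- sizes then forces `s = 1`.
    obtain ⟨s, -, q, hq, hsq⟩ : ∃ s : ℝ, 0 ≤ s ∧ p ∈ s • K := by
      refine Submodule.span_induction (p := fun q _ => ∃ s : ℝ, 0 ≤ s ∧ q ∈ s • K) ?_ ?_ ?_ ?_
        (mem_span_gen hpc.1)
      · rintro _ ⟨t, ht, rfl⟩
        have htA : t ∈ labels A := ⟨ht.1, ht.2.trans hpA⟩
        have hs := size_gen_pos ht.1 (hle t htA)
        refine ⟨size r (gen r t), hs.le, vertex r t, subset_convexHull ℝ _ ⟨t, htA, rfl⟩, ?_⟩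
        change size r (gen r t) • vertex r t = gen r t
        rw [vertex, smul_smul, mul_inv_cancel₀ hs.ne', one_smul]
      · obtain ⟨q, hq⟩ := hne
        exact ⟨0, le_rfl, q, hq, zero_smul _ _⟩
      · rintro x y - - ⟨s, hs, hx⟩ ⟨s', hs', hy⟩
        refine ⟨s + s', add_nonneg hs hs', ?_⟩
        rw [hKc.add_smul hs hs']
        exact Set.add_mem_add hx hy
      · rintro c x - ⟨s, hs, hx⟩
        refine ⟨c * s, mul_nonneg c.2 hs, ?_⟩
        rw [NNReal.smul_def, mul_smul]
        exact Set.smul_mem_smul_set hx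
    have hs1 : s = 1 := by
      have h := hpc.2
      rw [← hsq] at h
      change size r (s • q) = 1 at h
      rwa [map_smul, hsize q hq, smul_eq_mul, mul_one] at h
    have : p = q := by
      rw [← hsq, hs1]
      exact one_smul _ _
    rwa [this]
  · refine convexHull_min ?_ ((isExposed_face A).convex convex_kostkaPolytope)
    rintro _ ⟨t, ht, rfl⟩
    exact ⟨vertex_mem_kostkaPolytope ht.1 (hle t ht),
      (strictAt_vertex ht.1 (hle t ht)).le.trans ht.2⟩

/-- Vertices with disjoint label intervals span a face of the polytope. -/
theorem exists_face_of_isDisjointlyLabeled {d : ℕ} {v : Fin (d + 1) → KostkaSpace r}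
    (hv : IsDisjointlyLabeled r d v) :
    ∃ A ∈ facialUpTo d r, face r A = convexHull ℝ (Set.range v) ∧
      (labelValues A).ncard = 3 * d + 3 := by
  obtain ⟨t, ht, hdisj⟩ := hv
  have hsep : Separated (Set.range t) := by
    refine ⟨?_, ?_⟩
    · rintro _ ⟨i, rfl⟩
      exact (ht i).2
    · rintro _ ⟨i, rfl⟩ _ ⟨j, rfl⟩ hij
      exact hdisj i j fun h => hij (h ▸ rfl)
  have hinj : Function.Injective t := by
    intro i j hij
    by_contra hne
    have h := hdisj i j hne
    rw [hij, disjoint_self, Set.bot_eq_empty, Set.Icc_eq_empty_iff] at h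
    have := (ht j).2
    omega
  have hcard : (Set.range t).ncard = d + 1 := by
    rw [← Set.image_univ, hinj.injOn.ncard_image, Set.ncard_univ, Nat.card_fin]
  have hval : ∀ s ∈ Set.range t, Valid s := fun s hs => Or.inl (hsep.1 s hs)
  have hA : Facial (supportUnion (Set.range t)) := facial_supportUnion hval
  have hr : indices (supportUnion (Set.range t)) ⊆ Set.Icc 1 r := by
    intro n hn
    refine ⟨hA.pos_of_mem_indices hn, ?_⟩
    obtain ⟨s, hs, hns⟩ := hA.indices_subset_labelValues hn
    rw [hsep.labels_supportUnion] at hs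
    obtain ⟨i, rfl⟩ := hs
    have h1 := (ht i).1.2.1
    have h2 := (ht i).2
    omega
  refine ⟨_, ⟨hA, ?_, hr⟩, ?_, ?_⟩
  · rw [hsep.weight_supportUnion, hcard]
  · rw [face_eq_convexHull hr, hsep.labels_supportUnion, ← Set.range_comp]
    congr 2
    funext i
    exact (hasLabel_iff.1 (ht i).1).2.2.symm
  · rw [hsep.ncard_labelValues, hcard]
    ring

theorem ncard_labelEntries_le {d : ℕ} {F : Set (KostkaSpace r)} (hF : F ∈ kostkaFaces r d) :
    (labelEntries r F).ncard ≤ 3 * d + 3 := by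
  rw [kostkaFaces_eq] at hF
  obtain ⟨A, ⟨hA, hw, hr⟩, rfl⟩ := hF
  have := hA.ncard_labelValues_le ((Set.finite_Icc 1 r).subset hr)
  rw [labelEntries_face hr]
  omega

theorem isTopDegreeFace_iff {d : ℕ} {F : Set (KostkaSpace r)} :
    IsTopDegreeFace r d F ↔ ∃ v : Fin (d + 1) → KostkaSpace r,
      IsDisjointlyLabeled r d v ∧ F = convexHull ℝ (Set.range v) := by
  constructor
  · rintro ⟨hF, hcard⟩
    rw [kostkaFaces_eq] at hF
    obtain ⟨A, ⟨hA, hw, hr⟩, rfl⟩ := hF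
    rw [labelEntries_face hr] at hcard
    obtain ⟨hsep, hn⟩ := hA.separated_labels ((Set.finite_Icc 1 r).subset hr) (by omega)
    rw [hw, ← Nat.card_coe_set_eq] at hn
    have : Finite (labels A) := Nat.finite_of_card_ne_zero (by omega)
    let e : Fin (d + 1) ≃ labels A := (Finite.equivFinOfCardEq hn).symm
    refine ⟨fun i => vertex r (e i), ⟨fun i => e i, fun i => ⟨?_, hsep.1 _ (e i).2⟩, ?_⟩, ?_⟩
    · exact hasLabel_vertex (e i).2.1 (hr (a_mem_indices (e i).2)).2
    · exact fun i j hij => hsep.2 _ (e i).2 _ (e j).2 fun h =>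
        hij (e.injective (Subtype.ext h))
    · rw [face_eq_convexHull hr]
      congr 1
      ext p
      constructor
      · rintro ⟨t, ht, rfl⟩
        exact ⟨e.symm ⟨t, ht⟩, by simp⟩
      · rintro ⟨i, rfl⟩
        exact ⟨_, (e i).2, rfl⟩
  · rintro ⟨v, hv, rfl⟩
    obtain ⟨A, hA, hF, hcard⟩ := exists_face_of_isDisjointlyLabeled hv
    rw [← hF]
    refine ⟨?_, ?_⟩
    · rw [kostkaFaces_eq]
      exact ⟨A, hA, rfl⟩
    · rw [labelEntries_face hA.2.2, hcard]

/-- The convex hull of the `d + 1` points is a face of dimension `d`, which leaves no room for an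
affine dependence. -/
theorem affineIndependent_of_isDisjointlyLabeled {d : ℕ} {v : Fin (d + 1) → KostkaSpace r}
    (hv : IsDisjointlyLabeled r d v) : AffineIndependent ℝ v := by
  obtain ⟨A, hA, hF, -⟩ := exists_face_of_isDisjointlyLabeled hv
  rw [affineIndependent_iff_finrank_vectorSpan_eq ℝ v (Fintype.card_fin (d + 1)),
    ← direction_affineSpan, ← affineSpan_convexHull, ← hF, direction_affineSpan]
  have : face r A ∈ kostkaFaces r d := kostkaFaces_eq r d ▸ ⟨A, hA, rfl⟩
  exact this.2.2

end vertices

/-! ### From the binomial basis to a polynomial -/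

open Polynomial in
/-- An integer combination of binomial coefficients `C(r, k)`, `k ≤ n`, in which `C(r, n)` has
coefficient one, is a polynomial in `r` of degree `n` with leading coefficient `1 / n!`. -/
theorem exists_polynomial_eval_eq_sum_choose (α : ℕ → ℕ) (n : ℕ) (hα : α n = 1) :
    ∃ p : ℚ[X], p.natDegree = n ∧ p.leadingCoeff = 1 / ((n.factorial : ℕ) : ℚ) ∧
      ∀ r : ℕ, p.eval (r : ℚ) = ((∑ k ∈ Finset.range (n + 1), α k * r.choose k : ℕ) : ℚ) := by
  -- `b k` is the binomial coefficient `C(X, k)` as a polynomial, of degree `k` with leading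
  -- coefficient `1 / k!`; lower terms cannot affect that of `b n`.
  let b : ℕ → ℚ[X] := fun k => C (1 / ((k.factorial : ℕ) : ℚ)) * descPochhammer ℚ k
  have hb0 : ∀ k : ℕ, (1 / ((k.factorial : ℕ) : ℚ)) ≠ 0 := fun k =>
    one_div_ne_zero (Nat.cast_ne_zero.2 k.factorial_ne_zero)
  have hdeg : ∀ k, (b k).degree = k := fun k => by
    rw [degree_C_mul (hb0 k), degree_eq_natDegree (monic_descPochhammer ℚ k).ne_zero,
      descPochhammer_natDegree]
  have hlead : ∀ k, (b k).leadingCoeff = 1 / ((k.factorial : ℕ) : ℚ) := fun k => by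
    rw [leadingCoeff_mul, leadingCoeff_C, (monic_descPochhammer ℚ k).leadingCoeff, mul_one]
  have heval : ∀ k r : ℕ, (b k).eval (r : ℚ) = r.choose k := fun k r => by
    rw [eval_mul, eval_C, descPochhammer_eval_eq_descFactorial,
      Nat.descFactorial_eq_factorial_mul_choose, Nat.cast_mul, one_div,
      inv_mul_cancel_left₀ (Nat.cast_ne_zero.2 k.factorial_ne_zero)]
  let q : ℚ[X] := ∑ k ∈ Finset.range n, C (α k : ℚ) * b k
  have hq : q.degree < (b n).degree := by
    rw [hdeg]
    refine (degree_sum_le _ _).trans_lt ((Finset.sup_lt_iff (WithBot.bot_lt_coe n)).2 ?_)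
    intro k hk
    refine ((degree_mul_le _ _).trans (add_le_add degree_C_le le_rfl)).trans_lt ?_
    rw [zero_add, hdeg]
    exact WithBot.coe_lt_coe.2 (Finset.mem_range.1 hk)
  refine ⟨q + b n, ?_, ?_, fun r => ?_⟩
  · exact natDegree_eq_of_degree_eq_some ((degree_add_eq_right_of_degree_lt hq).trans (hdeg n))
  · rw [leadingCoeff_add_of_degree_lt hq, hlead]
  · rw [Finset.sum_range_succ, hα, one_mul, eval_add, heval, eval_finsetSum]
    push_cast
    congr 1
    refine Finset.sum_congr rfl fun k _ => ?_
    rw [eval_mul, eval_C, heval]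

end Kostka

theorem theorem5p6 (d : ℕ) :
    -- `f_d(r)` counts a finite set
    (∀ r : ℕ, 1 ≤ r → (kostkaFaces r d).Finite) ∧
    -- `f_d(r)` is a polynomial in `r` of degree `3d+3` with leading coefficient `1/(3d+3)!`
    (∃ p : Polynomial ℚ, p.natDegree = 3 * d + 3 ∧
      p.leadingCoeff = 1 / ((Nat.factorial (3 * d + 3) : ℕ) : ℚ) ∧
      ∀ r : ℕ, 1 ≤ r → (kostkaFaceNumber d r : ℚ) = p.eval (r : ℚ)) ∧
    -- in the binomial basis, the coefficient of `C(r, 3d+3)` is `1`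
    (∃ α : ℕ → ℕ, α (3 * d + 3) = 1 ∧
      ∀ r : ℕ, 1 ≤ r →
        kostkaFaceNumber d r = ∑ k ∈ Finset.range (3 * d + 4), α k * r.choose k) ∧
    -- the labels of a `d`-face have at most `3d+3` distinct entries
    (∀ r : ℕ, 1 ≤ r → ∀ F ∈ kostkaFaces r d, (labelEntries r F).ncard ≤ 3 * d + 3) ∧
    -- the top-degree faces are exactly the simplices with pairwise disjoint label intervals
    (∀ r : ℕ, 1 ≤ r → ∀ F : Set (KostkaSpace r),
      IsTopDegreeFace r d F ↔
        ∃ v : Fin (d + 1) → KostkaSpace r,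
          IsDisjointlyLabeled r d v ∧ F = convexHull ℝ (Set.range v)) ∧
    (∀ r : ℕ, 1 ≤ r → ∀ v : Fin (d + 1) → KostkaSpace r,
      IsDisjointlyLabeled r d v → AffineIndependent ℝ v) := by
  refine ⟨fun r _ => Kostka.finite_kostkaFaces r d, ?_,
    ⟨Kostka.facialCount d, Kostka.facialCount_top d, fun r _ =>
      Kostka.kostkaFaceNumber_eq_sum d r⟩,
    fun r _ F hF => Kostka.ncard_labelEntries_le hF, fun r _ F => Kostka.isTopDegreeFace_iff,
    fun r _ v hv => Kostka.affineIndependent_of_isDisjointlyLabeled hv⟩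
  obtain ⟨p, h1, h2, h3⟩ := Kostka.exists_polynomial_eval_eq_sum_choose (Kostka.facialCount d)
    (3 * d + 3) (Kostka.facialCount_top d)
  exact ⟨p, h1, h2, fun r _ => by rw [h3, Kostka.kostkaFaceNumber_eq_sum]⟩
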